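/- Let $u(t):=\sin(2\pi t)$. For $h:\mathbb{R}\to\mathbb{R}$, $\delta>0$ and $x,t\in\mathbb R$ put $y_\delta(x,t):=h(x+\delta u(t))$ and $a_{0,\delta}(x):=2\int_0^1 y_\delta(x,t)\,dt$. For $\gamma>0$ and initial data $(x_0,\bar y_0)\in\mathbb{R}^2$ consider the extremum seeking scheme with high-pass filter $$\dot x=-\gamma\,(y_\delta(x,t)-\bar y)\,u(t),\quad x(0)=x_0,\qquad \dot{\bar y}=\gamma\,(y_\delta(x,t)-\bar y),\quad \bar y(0)=\bar y_0 .\tag{1}$$ Consider the following assumptions. (A1) $h$ is smooth and $x^\star\in\mathbb{R}$ satisfies $h(x)-h(x^\star)>0$ for all $x\neq x^\star$. (A2) $A\ge 0$ is a real number, $m:\mathbb{R}\to\mathbb{R}$ is locally Lipschitz and strictly quasi-convex (that is, $m(x)<m(y)$ implies $m(z)<m(y)$ for every $z$ strictly between $x$ and $y$), and $\alpha:[0,\infty)\to[0,\infty)$ is of class $\mathcal K_\infty$ (continuous, strictly increasing, unbounded, $\alpha(0)=0$), such that $m(x)-A\le h(x)\le m(x)+A$ for all $x\in\mathbb{R}$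 and $|m(x_2)-m(x_1)|\ge\alpha(|x_2-x_1|)$ for all $x_1,x_2\in\mathbb{R}$ with $(x_1-x^\star)(x_2-x^\star)\ge 0$. Given $\alpha$, let $\underline\delta^\star(s):=2\int_0^{1/2}\alpha(s\sin(2\pi t))\,dt$ for $s\geq 0$. **Theorem.** For every $L\ge 0$ and every $\epsilon>0$ there are $\gamma^\star>0$ and $\bar\delta>0$, depending only on $L$ and $\epsilon$, with the following property. Let $h$ and $x^\star$ satisfy (A1), let $h$ be globally Lipschitz with constant $L$, and let $m,\alpha,A$ satisfy (A2). Let $\gamma\in(0,\gamma^\star)$ and $\delta\in(0,\bar\delta]$, with $\underline\delta^\star(\delta)\ge A+\bar b$ for some $\bar b>0$. Then for all $x_0\in\mathbb{R}$ and $\bar y_0\in\mathbb{R}$ with $|\bar y_0-a_{0,\delta}(x_0)/2|\le\gamma$, system (1) has a solution on $[0,\infty)$, and every such solution $(x,\bar y)$ is bounded and satisfies $$\limsup_{t\to\infty}|x(t)-x^\star|\le\epsilon .$$ -/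

import Mathlib

open Set Filter Topology
open scoped NNReal ContDiff

noncomputable section

namespace ExtremumSeeking

/-- The dither signal `u(t) = sin (2 π t)`. -/
def dither (t : ℝ) : ℝ := Real.sin (2 * Real.pi * t)

/-- The perturbed output `y_δ(x, t) = h (x + δ u(t))`. -/
def output (h : ℝ → ℝ) (δ x t : ℝ) : ℝ := h (x + δ * dither t)

/-- The cosine Fourier coefficients
`a_{k,δ}(x) = 2 ∫₀¹ y_δ(x, t) cos (k 2 π t) dt` of the output. -/
def fourierCos (h : ℝ → ℝ) (δ : ℝ) (k : ℕ) (x : ℝ) : ℝ :=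
  2 * ∫ t in (0 : ℝ)..1, output h δ x t * Real.cos ((k : ℝ) * (2 * Real.pi * t))

/-- `α` restricted to `[0, ∞)` is a function of class `K_∞`: continuous, strictly increasing,
zero at zero and unbounded. (The values of `α` on negative numbers are irrelevant.) -/
structure ClassKInfty (α : ℝ → ℝ) : Prop where
  continuousOn : ContinuousOn α (Ici 0)
  strictMonoOn : StrictMonoOn α (Ici 0)
  map_zero : α 0 = 0
  tendsto_atTop : Tendsto α atTop atTop

/-- Strict quasi-convexity in the sense of Karamardian: at every point strictly between two
points with different values, the function is strictly below the larger of the two values. -/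
def StrictlyQuasiconvex (m : ℝ → ℝ) : Prop :=
  ∀ x y : ℝ, m x < m y → ∀ a b : ℝ, 0 < a → 0 < b → a + b = 1 → m (a * x + b * y) < m y

/-- The cost function `h` is smooth and `xs` is its strict global minimiser. -/
structure SmoothWithMinimiser (h : ℝ → ℝ) (xs : ℝ) : Prop where
  smooth : ContDiff ℝ ∞ h
  minimiser : ∀ x : ℝ, x ≠ xs → 0 < h x - h xs

/-- The cost function `h` stays within the distance `A` of a locally Lipschitz, strictly
quasi-convex function `m`, whose increments on either side of `xs` are bounded from below by the
class `K_∞` function `α`. -/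
structure QuasiconvexApprox (h : ℝ → ℝ) (xs : ℝ) (m α : ℝ → ℝ) (A : ℝ) : Prop where
  locallyLipschitz : LocallyLipschitz m
  strictlyQuasiconvex : StrictlyQuasiconvex m
  classKInfty : ClassKInfty α
  nonneg : 0 ≤ A
  lower : ∀ x : ℝ, m x - A ≤ h x
  upper : ∀ x : ℝ, h x ≤ m x + A
  growth : ∀ x₁ x₂ : ℝ, 0 ≤ (x₁ - xs) * (x₂ - xs) → α |x₂ - x₁| ≤ |m x₂ - m x₁|

/-- The function `δ⋆(s) = 2 ∫₀^{1/2} α (s sin (2 π t)) dt`. -/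
def deltaStar (α : ℝ → ℝ) (s : ℝ) : ℝ :=
  2 * ∫ t in (0 : ℝ)..(1 / 2), α (s * Real.sin (2 * Real.pi * t))

/-- `(x, y)` is a trajectory, on `[0, ∞)`, of the extremum seeking scheme with high-pass filter
`x' = -γ (y_δ(x, t) - y) u(t)`, `y' = γ (y_δ(x, t) - y)`, `x(0) = x₀`, `y(0) = y₀`. -/
structure IsTrajectory (h : ℝ → ℝ) (γ δ x₀ y₀ : ℝ) (x y : ℝ → ℝ) : Prop where
  init_x : x 0 = x₀
  init_y : y 0 = y₀
  deriv_x : ∀ t : ℝ, 0 ≤ t →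
    HasDerivWithinAt x (-γ * (output h δ (x t) t - y t) * dither t) (Ici 0) t
  deriv_y : ∀ t : ℝ, 0 ≤ t →
    HasDerivWithinAt y (γ * (output h δ (x t) t - y t)) (Ici 0) t

end ExtremumSeeking

end

/-!
Sample the trajectory once per period of the dither, and let `D` be the averaged drift, `M` the
oscillation of the output over a period, and `z` the difference between the filter state `y` and
the averaged output, all with the state frozen at `x`. Over one period `x` moves by `-γ D` and `z`
is contracted by the factor `1 - γ`, up to `L γ |D|` in `z` and errors of order `γ² (M + |z|)`
(`IsTrajectory.period_estimate`, `IsTrajectory.sampled_bounds`).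

The margin `b` in `A + b ≤ δ⋆(δ)` may be arbitrarily small compared with `γ`, so the averaging error
cannot be absorbed by a lower bound on `D`. Instead the error is bounded by the drift itself: at
distance at least `δ` from the minimiser, `D` points in the right direction, is at least `b / 2` in
size, and `M ≤ 220 |D|` with a universal constant (`drift_of_approx`). Indeed, `m` increases to the
right of the minimiser, and Chebyshev's inequality bounds its drift below by its oscillation and by
`(2 / π) (A + b)`, while replacing `m` by `h` costs at most `2 A / π`. This alone would leave only a
multiple of `b`. But Chebyshev's inequality is sharp only for constant functions, and `α` cannot
act as one: an increment of `m` over an interval is at least the sum of the increments that `α`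
demands over its two halves, so wherever `2 α (· / 2)` is larger it may be used in place of `α`. This
gains a fixed proportion of the drift of `m` (`integral_half_wave_gain`), and what remains for `h` is
comparable with the drift of `m`, hence with both `A` and `M`.

Consequently `|x - x⋆| + 4 K γ |z|`, with `K = 2 (L + 1)²`, decreases by a fixed amount per period
while `|x - x⋆| ≥ δ`, and is `δ + O(γ)` one period after any sample with `|x - x⋆| < δ`
(`lyapunov_recursion`). Within a period the state moves by `O(γ)` only, which gives boundedness and
the bound on the limit superior. Global existence follows from the global Lipschitz bound on `h`
(`exists_isTrajectory`).
-/

namespace ExtremumSeeking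

/-! ### Integrals over the half-wave of the dither -/

theorem continuous_dither : Continuous dither := by
  unfold dither; fun_prop

theorem abs_dither_le_one (t : ℝ) : |dither t| ≤ 1 := Real.abs_sin_le_one _

theorem dither_mem_Icc (t : ℝ) : dither t ∈ Icc (-1 : ℝ) 1 := abs_le.1 (abs_dither_le_one t)

theorem dither_add_half (t : ℝ) : dither (t + 1 / 2) = -dither t := by
  unfold dither
  rw [show 2 * Real.pi * (t + 1 / 2) = 2 * Real.pi * t + Real.pi by ring, Real.sin_add_pi]

theorem dither_nat_add (n : ℕ) (t : ℝ) : dither (n + t) = dither t := by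
  unfold dither
  rw [show 2 * Real.pi * (n + t) = 2 * Real.pi * t + n * (2 * Real.pi) by ring,
    Real.sin_add_nat_mul_two_pi]

theorem dither_one_sub (t : ℝ) : dither (1 - t) = -dither t := by
  unfold dither
  rw [show 2 * Real.pi * (1 - t) = 2 * Real.pi - 2 * Real.pi * t by ring, Real.sin_two_pi_sub]

theorem dither_nonneg {t : ℝ} (ht : t ∈ Icc (0 : ℝ) (1 / 2)) : 0 ≤ dither t := by
  have := Real.pi_pos
  exact Real.sin_nonneg_of_nonneg_of_le_pi (by have := ht.1; positivity)
    (by nlinarith [ht.2])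

theorem dither_mem_Icc_zero_one {t : ℝ} (ht : t ∈ Icc (0 : ℝ) (1 / 2)) :
    dither t ∈ Icc (0 : ℝ) 1 :=
  ⟨dither_nonneg ht, (dither_mem_Icc t).2⟩

theorem integral_dither (a b : ℝ) :
    ∫ t in a..b, dither t
      = (Real.cos (2 * Real.pi * a) - Real.cos (2 * Real.pi * b)) / (2 * Real.pi) := by
  unfold dither
  rw [intervalIntegral.integral_comp_mul_left (fun t => Real.sin t)
    (by have := Real.pi_pos; positivity), integral_sin, smul_eq_mul]
  ring

theorem integral_dither_half : ∫ t in (0 : ℝ)..(1 / 2), dither t = 1 / Real.pi := by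
  have := Real.pi_pos
  rw [integral_dither, show 2 * Real.pi * (1 / 2) = Real.pi by ring]
  simp only [mul_zero, Real.cos_zero, Real.cos_pi]
  field_simp
  norm_num

theorem integral_dither_period : ∫ t in (0 : ℝ)..1, dither t = 0 := by
  rw [integral_dither]
  simp

/-- Folding an average over one period of the dither onto its positive half-wave. -/
theorem integral_comp_dither {f : ℝ → ℝ} (hf : Continuous f) :
    ∫ t in (0 : ℝ)..1, f (dither t) = ∫ t in (0 : ℝ)..(1 / 2), (f (dither t) + f (-dither t)) := by
  have hc : Continuous fun t => f (dither t) := hf.comp continuous_dither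
  have hc' : Continuous fun t => f (-dither t) := hf.comp continuous_dither.neg
  rw [intervalIntegral.integral_add (hc.intervalIntegrable _ _) (hc'.intervalIntegrable _ _),
    ← intervalIntegral.integral_add_adjacent_intervals (hc.intervalIntegrable 0 (1 / 2))
      (hc.intervalIntegrable (1 / 2) 1)]
  congr 1
  have := intervalIntegral.integral_comp_add_right (a := (0 : ℝ)) (b := 1 / 2)
    (fun t => f (dither t)) (1 / 2)
  simp only [dither_add_half] at this
  rw [this]
  norm_num

theorem intervalIntegrable_comp_dither {φ : ℝ → ℝ} (hc : ContinuousOn φ (Icc 0 1)) {a b : ℝ}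
    (h0 : 0 ≤ a) (hab : a ≤ b) (hb : b ≤ 1 / 2) :
    IntervalIntegrable (fun t => φ (dither t)) MeasureTheory.volume a b := by
  apply ContinuousOn.intervalIntegrable_of_Icc hab
  exact hc.comp continuous_dither.continuousOn fun t ht =>
    dither_mem_Icc_zero_one ⟨h0.trans ht.1, ht.2.trans hb⟩

/-- Chebyshev's sum inequality for the half-wave: the mean of the dither over `[0, 1/2]` is
`2 / π`. -/
theorem two_div_pi_mul_integral_le {φ : ℝ → ℝ} (hc : ContinuousOn φ (Icc 0 1))
    (hm : MonotoneOn φ (Icc 0 1)) :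
    2 / Real.pi * ∫ t in (0 : ℝ)..(1 / 2), φ (dither t)
      ≤ ∫ t in (0 : ℝ)..(1 / 2), φ (dither t) * dither t := by
  have hpi := Real.pi_gt_three
  set s₀ : ℝ := 2 / Real.pi with hs₀
  have hs : s₀ ∈ Icc (0 : ℝ) 1 := ⟨by positivity, by rw [hs₀, div_le_one (by positivity)]; linarith⟩
  have i1 := intervalIntegrable_comp_dither hc le_rfl (by norm_num : (0 : ℝ) ≤ 1 / 2) le_rfl
  have i2 : IntervalIntegrable (fun t => φ (dither t) * dither t) MeasureTheory.volume 0 (1 / 2) :=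
    intervalIntegrable_comp_dither (φ := fun s => φ s * s) (hc.mul continuousOn_id) le_rfl
      (by norm_num) le_rfl
  have key : ∫ t in (0 : ℝ)..(1 / 2), φ s₀ * (dither t - s₀)
      ≤ ∫ t in (0 : ℝ)..(1 / 2), (φ (dither t) * dither t - s₀ * φ (dither t)) := by
    apply intervalIntegral.integral_mono_on (by norm_num)
    · exact (continuous_const.mul (continuous_dither.sub continuous_const)).intervalIntegrable _ _
    · exact i2.sub (i1.const_mul _)
    · intro t ht
      have hd := dither_mem_Icc_zero_one ht
      rcases le_total (dither t) s₀ with h | h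
      · nlinarith [hm hd hs h]
      · nlinarith [hm hs hd h]
  rw [intervalIntegral.integral_sub i2 (i1.const_mul _), intervalIntegral.integral_const_mul,
    intervalIntegral.integral_const_mul, intervalIntegral.integral_sub
      (continuous_dither.intervalIntegrable _ _) intervalIntegrable_const,
    integral_dither_half, intervalIntegral.integral_const] at key
  have : 1 / Real.pi - (1 / 2 - 0 : ℝ) • s₀ = 0 := by
    rw [hs₀, smul_eq_mul]; field_simp; norm_num
  rw [this] at key
  linarith

theorem le_cos_pi_div_sixteen : (0.98 : ℝ) ≤ Real.cos (Real.pi / 16) := by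
  have h := Real.one_sub_sq_div_two_le_cos (x := Real.pi / 16)
  have := Real.pi_lt_d2
  have := Real.pi_pos
  nlinarith

theorem half_le_dither {t : ℝ} (ht : t ∈ Icc (1 / 12 : ℝ) (5 / 12)) : 1 / 2 ≤ dither t := by
  have hpp := Real.pi_pos
  have h1 := mul_le_mul_of_nonneg_left ht.1 hpp.le
  have h2 := mul_le_mul_of_nonneg_left ht.2 hpp.le
  rw [← Real.cos_pi_div_three]
  unfold dither
  rw [← Real.cos_sub_pi_div_two, ← Real.cos_abs (_ - _)]
  apply Real.cos_le_cos_of_nonneg_of_le_pi (abs_nonneg _) (by linarith)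
  rw [abs_le]
  constructor <;> linarith

/-- A lower bound for the dilated function in terms of `φ (1 / 4)`, from the part of the half-wave
where the dither is at least `1 / 2`. -/
theorem integral_half_scale_ge {φ : ℝ → ℝ} (hc : ContinuousOn φ (Icc 0 1))
    (hm : MonotoneOn φ (Icc 0 1)) (h0 : 0 ≤ φ 0) :
    0.8 * (1 / Real.pi * φ (1 / 4))
      ≤ ∫ t in (0 : ℝ)..(1 / 2), φ (dither t / 2) * dither t := by
  have hpp := Real.pi_pos
  have hr : (1 / 4 : ℝ) ∈ Icc (0 : ℝ) 1 := by norm_num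
  have hv0 : 0 ≤ φ (1 / 4) := h0.trans (hm (by norm_num) hr (by norm_num))
  have i3 : ∀ {a b : ℝ} (_ : 0 ≤ a) (_ : a ≤ b) (_ : b ≤ 1 / 2),
      IntervalIntegrable (fun t => φ (dither t / 2) * dither t) MeasureTheory.volume a b :=
    fun h0 hab hb => intervalIntegrable_comp_dither (φ := fun s => φ (s / 2) * s)
      ((hc.comp (by fun_prop) fun s hs => ⟨by linarith [hs.1], by linarith [hs.2]⟩).mul
        continuousOn_id) h0 hab hb
  have e1 : φ (1 / 4) * ∫ t in (1 / 12 : ℝ)..(5 / 12), dither t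
      ≤ ∫ t in (1 / 12 : ℝ)..(5 / 12), φ (dither t / 2) * dither t := by
    rw [← intervalIntegral.integral_const_mul]
    refine intervalIntegral.integral_mono_on (by norm_num)
      ((continuous_dither.intervalIntegrable _ _).const_mul _)
      (i3 (by norm_num) (by norm_num) (by norm_num)) ?_
    intro t ht
    have hd := dither_mem_Icc_zero_one (t := t) ⟨by linarith [ht.1], by linarith [ht.2]⟩
    have hhalf := half_le_dither ht
    exact mul_le_mul_of_nonneg_right
      (hm hr ⟨by linarith [hd.1], by linarith [hd.2]⟩ (by linarith)) hd.1
  have e2 : ∫ t in (1 / 12 : ℝ)..(5 / 12), φ (dither t / 2) * dither t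
      ≤ ∫ t in (0 : ℝ)..(1 / 2), φ (dither t / 2) * dither t := by
    refine intervalIntegral.integral_mono_interval (by norm_num) (by norm_num) (by norm_num)
      ?_ (i3 le_rfl (by norm_num) le_rfl)
    filter_upwards [MeasureTheory.ae_restrict_mem measurableSet_Ioc] with t ht
    have hd := dither_mem_Icc_zero_one ⟨ht.1.le, ht.2⟩
    exact mul_nonneg (h0.trans (hm (by norm_num) ⟨by linarith [hd.1], by linarith [hd.2]⟩
      (by linarith [hd.1]))) hd.1
  have c4 : Real.cos (2 * Real.pi * (1 / 12)) = √3 / 2 := by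
    rw [← Real.cos_pi_div_six]; congr 1; ring
  have c5 : Real.cos (2 * Real.pi * (5 / 12)) = -(√3 / 2) := by
    rw [← Real.cos_pi_div_six, ← Real.cos_pi_sub]; congr 1; ring
  rw [integral_dither, c4, c5] at e1
  have h3 : 1.7 ≤ √3 := Real.le_sqrt_of_sq_le (by norm_num)
  refine le_trans ?_ (e1.trans e2)
  have e3 : φ (1 / 4) * ((√3 / 2 - -(√3 / 2)) / (2 * Real.pi))
      = √3 / 2 * (1 / Real.pi * φ (1 / 4)) := by field_simp; ring
  rw [e3]
  exact mul_le_mul_of_nonneg_right (by linarith) (by positivity)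

/-- A quantitative strengthening of Chebyshev's inequality: trading a small part of `φ` for the
doubled and dilated function `2 φ (· / 2)` gains a definite factor. -/
theorem integral_half_wave_gain {φ : ℝ → ℝ} (hc : ContinuousOn φ (Icc 0 1))
    (hm : MonotoneOn φ (Icc 0 1)) (h0 : 0 ≤ φ 0) :
    1.03 * (2 / Real.pi) * ∫ t in (0 : ℝ)..(1 / 2), φ (dither t)
      ≤ 0.95 * (∫ t in (0 : ℝ)..(1 / 2), φ (dither t) * dither t)
        + 0.1 * ∫ t in (0 : ℝ)..(1 / 2), φ (dither t / 2) * dither t := by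
  have hpi := Real.pi_gt_d2
  have hpi' := Real.pi_lt_d2
  have hpp := Real.pi_pos
  have hinv : 1 / Real.pi < 0.319 := by rw [div_lt_iff₀ hpp]; linarith
  have hinv0 : 0 < 1 / Real.pi := by positivity
  -- `s₁` is the zero of the weight `k s = 0.95 s - 1.03 (2 / π)`
  set q : ℝ := 1 / Real.pi with hq
  have h2q : 2 / Real.pi = 2 * q := by rw [hq]; ring
  rw [h2q]
  set s₁ : ℝ := 1.03 * (2 * q) / 0.95 with hs₁
  have hs₁' : 0.95 * s₁ = 1.03 * (2 * q) := by rw [hs₁]; ring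
  have hs : s₁ ∈ Icc (0 : ℝ) 1 := ⟨by linarith, by linarith⟩
  have hr : (1 / 4 : ℝ) ∈ Icc (0 : ℝ) 1 := by norm_num
  have hv0 : 0 ≤ φ (1 / 4) := h0.trans (hm (by norm_num) hr (by norm_num))
  have hq3 : 0.3 < q := by rw [hq, lt_div_iff₀ hpp]; linarith
  have hvw : φ (1 / 4) ≤ φ s₁ := hm hr hs (by linarith)
  set v := φ (1 / 4) with hv
  set w := φ s₁ with hw
  set k : ℝ → ℝ := fun t => 0.95 * dither t - 1.03 * (2 * q) with hk
  have hkc : Continuous k := (continuous_const.mul continuous_dither).sub continuous_const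
  have hkint : ∀ a b : ℝ, ∫ t in a..b, k t
      = 0.95 * ((Real.cos (2 * Real.pi * a) - Real.cos (2 * Real.pi * b)) / (2 * Real.pi))
        - (b - a) * (1.03 * (2 * q)) := by
    intro a b
    have hi : IntervalIntegrable (fun t => 0.95 * dither t) MeasureTheory.volume a b :=
      (continuous_dither.intervalIntegrable _ _).const_mul _
    simp only [hk]
    rw [intervalIntegral.integral_sub hi intervalIntegrable_const,
      intervalIntegral.integral_const_mul, integral_dither, intervalIntegral.integral_const,
      smul_eq_mul]
  have i1 := fun {a b : ℝ} (h0 : 0 ≤ a) (hab : a ≤ b) (hb : b ≤ 1 / 2) =>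
    intervalIntegrable_comp_dither hc h0 hab hb
  have i2 : ∀ {a b : ℝ} (_ : 0 ≤ a) (_ : a ≤ b) (_ : b ≤ 1 / 2),
      IntervalIntegrable (fun t => φ (dither t) * k t) MeasureTheory.volume a b :=
    fun h0 hab hb => (i1 h0 hab hb).mul_continuousOn hkc.continuousOn
  have i4 : IntervalIntegrable (fun t => φ (dither t) * dither t) MeasureTheory.volume 0 (1 / 2) :=
    (i1 le_rfl (by norm_num) le_rfl).mul_continuousOn continuous_dither.continuousOn
  -- near the ends of the half-wave the dither is at most `1 / 4`, and the weight is negative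
  have hsmall : ∀ t : ℝ, 0 ≤ t → t ≤ 1 / 32 → dither t ≤ 1 / 4 := by
    intro t ht ht'
    have h1 : dither t ≤ 2 * Real.pi * t := Real.sin_le (by positivity)
    nlinarith
  have hsymm : ∀ t : ℝ, dither (1 / 2 - t) = dither t := by
    intro t
    unfold dither
    rw [show 2 * Real.pi * (1 / 2 - t) = Real.pi - 2 * Real.pi * t by ring, Real.sin_pi_sub]
  have hend : ∀ t ∈ Icc (0 : ℝ) (1 / 2), dither t ≤ 1 / 4 → v * k t ≤ φ (dither t) * k t := by
    intro t ht hd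
    have hd' := dither_mem_Icc_zero_one ht
    have h1 : φ (dither t) ≤ v := hm hd' hr hd
    have h2 : k t ≤ 0 := by simp only [hk]; linarith
    nlinarith
  have hmid : ∀ t ∈ Icc (0 : ℝ) (1 / 2), w * k t ≤ φ (dither t) * k t := by
    intro t ht
    have hd' := dither_mem_Icc_zero_one ht
    rcases le_total (dither t) s₁ with h | h
    · have h1 : φ (dither t) ≤ w := hm hd' hs h
      have h2 : k t ≤ 0 := by simp only [hk]; linarith
      nlinarith
    · have h1 : w ≤ φ (dither t) := hm hs hd' h
      have h2 : 0 ≤ k t := by simp only [hk]; linarith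
      nlinarith
  have e1 : v * ∫ t in (0 : ℝ)..(1 / 32), k t ≤ ∫ t in (0 : ℝ)..(1 / 32), φ (dither t) * k t := by
    rw [← intervalIntegral.integral_const_mul]
    refine intervalIntegral.integral_mono_on (by norm_num)
      ((continuous_const.mul hkc).intervalIntegrable _ _) (i2 le_rfl (by norm_num) (by norm_num)) ?_
    intro t ht
    exact hend t ⟨ht.1, ht.2.trans (by norm_num)⟩ (hsmall t ht.1 ht.2)
  have e2 : w * ∫ t in (1 / 32 : ℝ)..(15 / 32), k t
      ≤ ∫ t in (1 / 32 : ℝ)..(15 / 32), φ (dither t) * k t := by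
    rw [← intervalIntegral.integral_const_mul]
    refine intervalIntegral.integral_mono_on (by norm_num)
      ((continuous_const.mul hkc).intervalIntegrable _ _)
      (i2 (by norm_num) (by norm_num) (by norm_num)) ?_
    intro t ht
    exact hmid t ⟨by linarith [ht.1], by linarith [ht.2]⟩
  have e3 : v * ∫ t in (15 / 32 : ℝ)..(1 / 2), k t
      ≤ ∫ t in (15 / 32 : ℝ)..(1 / 2), φ (dither t) * k t := by
    rw [← intervalIntegral.integral_const_mul]
    refine intervalIntegral.integral_mono_on (by norm_num)
      ((continuous_const.mul hkc).intervalIntegrable _ _)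
      (i2 (by norm_num) (by norm_num) (by norm_num)) ?_
    intro t ht
    refine hend t ⟨by linarith [ht.1], ht.2⟩ ?_
    rw [← hsymm]
    exact hsmall _ (by linarith [ht.2]) (by linarith [ht.1])
  have e4 : ∫ t in (0 : ℝ)..(1 / 2), φ (dither t) * k t
      = (∫ t in (0 : ℝ)..(1 / 32), φ (dither t) * k t)
        + (∫ t in (1 / 32 : ℝ)..(15 / 32), φ (dither t) * k t)
        + ∫ t in (15 / 32 : ℝ)..(1 / 2), φ (dither t) * k t := by
    rw [intervalIntegral.integral_add_adjacent_intervals (i2 le_rfl (by norm_num) (by norm_num))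
      (i2 (by norm_num) (by norm_num) (by norm_num)),
      intervalIntegral.integral_add_adjacent_intervals (i2 le_rfl (by norm_num) (by norm_num))
      (i2 (by norm_num) (by norm_num) (by norm_num))]
  have c1 : Real.cos (2 * Real.pi * (15 / 32)) = -Real.cos (Real.pi / 16) := by
    rw [← Real.cos_pi_sub]; congr 1; ring
  have c2 : Real.cos (2 * Real.pi * (1 / 32)) = Real.cos (Real.pi / 16) := by congr 1; ring
  have c3 : Real.cos (2 * Real.pi * (1 / 2)) = -1 := by
    rw [← Real.cos_pi]; congr 1; ring
  have hdiv : ∀ x : ℝ, x / (2 * Real.pi) = x * q / 2 := by intro x; rw [hq]; field_simp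
  have hJ := le_cos_pi_div_sixteen
  rw [hkint, hdiv, c2] at e1
  rw [hkint, hdiv, c1, c2] at e2
  rw [hkint, hdiv, c1, c3] at e3
  simp only [mul_zero, Real.cos_zero] at e1
  set C := Real.cos (Real.pi / 16) with hC
  have e5 : -(0.08 * q * v) ≤ ∫ t in (0 : ℝ)..(1 / 2), φ (dither t) * k t := by
    have : 0 ≤ (w - v) * (0.95 * (C * q) - 0.90125 * q) :=
      mul_nonneg (by linarith) (by nlinarith)
    rw [e4]
    linarith
  have e7 := integral_half_scale_ge hc hm h0
  rw [← hq, ← hv] at e7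
  have e8 : ∫ t in (0 : ℝ)..(1 / 2), φ (dither t) * k t
      = 0.95 * (∫ t in (0 : ℝ)..(1 / 2), φ (dither t) * dither t)
        - 1.03 * (2 * q) * ∫ t in (0 : ℝ)..(1 / 2), φ (dither t) := by
    rw [← intervalIntegral.integral_const_mul, ← intervalIntegral.integral_const_mul,
      ← intervalIntegral.integral_sub (i4.const_mul _) ((i1 le_rfl (by norm_num) le_rfl).const_mul _)]
    congr 1
    ext t
    simp only [hk]
    ring
  rw [e8] at e5
  linarith

/-! ### The averaged drift -/

/-- The average of the output over one period of the dither, with the state frozen at `x`. -/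
noncomputable def meanOutput (h : ℝ → ℝ) (δ x : ℝ) : ℝ :=
  ∫ t in (0 : ℝ)..1, output h δ x t

/-- The averaged product of output and dither, with the state frozen at `x`. To first order in
the gain `γ`, one period moves the state `x` by `-γ` times this number. -/
noncomputable def averagedDrift (h : ℝ → ℝ) (δ x : ℝ) : ℝ :=
  ∫ t in (0 : ℝ)..1, output h δ x t * dither t

/-- The mean absolute deviation of the output from its average over one period of the dither. -/
noncomputable def oscillation (h : ℝ → ℝ) (δ x : ℝ) : ℝ :=
  ∫ t in (0 : ℝ)..1, |output h δ x t - meanOutput h δ x|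

theorem integral_abs_sub_mean_le {f : ℝ → ℝ} (hf : Continuous f) (c : ℝ) :
    ∫ t in (0 : ℝ)..1, |f t - ∫ s in (0 : ℝ)..1, f s| ≤ 2 * ∫ t in (0 : ℝ)..1, |f t - c| := by
  set a := ∫ s in (0 : ℝ)..1, f s with ha
  have hi : IntervalIntegrable (fun t => |f t - c|) MeasureTheory.volume 0 1 :=
    (Continuous.abs (hf.sub continuous_const)).intervalIntegrable _ _
  have h1 : a - c = ∫ t in (0 : ℝ)..1, (f t - c) := by
    rw [intervalIntegral.integral_sub (hf.intervalIntegrable _ _) intervalIntegrable_const,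
      intervalIntegral.integral_const, ha]
    simp
  have h2 : |a - c| ≤ ∫ t in (0 : ℝ)..1, |f t - c| := by
    rw [h1]; exact intervalIntegral.abs_integral_le_integral_abs zero_le_one
  calc ∫ t in (0 : ℝ)..1, |f t - a| ≤ ∫ t in (0 : ℝ)..1, (|f t - c| + |a - c|) := by
        refine intervalIntegral.integral_mono_on zero_le_one
          ((Continuous.abs (hf.sub continuous_const)).intervalIntegrable _ _)
          (hi.add intervalIntegrable_const) fun t _ => ?_
        rw [abs_sub_comm a c]
        exact abs_sub_le _ _ _
    _ = (∫ t in (0 : ℝ)..1, |f t - c|) + |a - c| := by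
        rw [intervalIntegral.integral_add hi intervalIntegrable_const,
          intervalIntegral.integral_const]
        simp
    _ ≤ _ := by linarith

/-- The averaged drift of a function `H` within distance `A` of an increasing function `F`: it is
positive and it dominates the oscillation of `H` with a universal constant. That constant does not
involve the margin `b`; the reason is the definite gain in `integral_half_wave_gain`, which makes
the drift of `F` exceed what the perturbation of size `A` can cancel by a fixed proportion. -/
theorem drift_of_near_monotone {F H φ : ℝ → ℝ} {A b : ℝ} (hF : Continuous F) (hH : Continuous H)
    (hFm : MonotoneOn F (Icc (-1) 1)) (hHF : ∀ s ∈ Icc (-1 : ℝ) 1, |H s - F s| ≤ A)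
    (hc : ContinuousOn φ (Icc 0 1)) (hm : MonotoneOn φ (Icc 0 1)) (h0 : 0 ≤ φ 0)
    (hφ : ∀ s ∈ Icc (-1 : ℝ) 1, ∀ r ∈ Icc (-1 : ℝ) 1, s ≤ r → r - s ≤ 1 → φ (r - s) ≤ F r - F s)
    (hA : 0 ≤ A) (hb : 0 < b) (hAb : A + b ≤ 2 * ∫ t in (0 : ℝ)..(1 / 2), φ (dither t)) :
    b / 2 ≤ (∫ t in (0 : ℝ)..1, H (dither t) * dither t) ∧
    (∫ t in (0 : ℝ)..1, |H (dither t) - ∫ s in (0 : ℝ)..1, H (dither s)|)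
      ≤ 220 * ∫ t in (0 : ℝ)..1, H (dither t) * dither t := by
  have hpi := Real.pi_gt_d2
  have hpi' := Real.pi_lt_d2
  have hpp := Real.pi_pos
  set g : ℝ → ℝ := fun s => F s - F (-s) with hg
  have hgc : Continuous g := hF.sub (hF.comp continuous_neg)
  have hu := continuous_dither
  have hgu : Continuous fun t => g (dither t) := hgc.comp hu
  have hgm : MonotoneOn g (Icc 0 1) := by
    intro s hs r hr hsr
    have h1 := hFm (a := s) (b := r) ⟨by linarith [hs.1], hs.2⟩ ⟨by linarith [hr.1], hr.2⟩ hsr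
    have h2 := hFm (a := -r) (b := -s) ⟨by linarith [hr.2], by linarith [hr.1]⟩
      ⟨by linarith [hs.2], by linarith [hs.1]⟩ (by linarith)
    simp only [hg]; linarith
  -- splitting `[-s, s]` into two, respectively four, intervals of equal length
  have hg2 : ∀ s ∈ Icc (0 : ℝ) 1, 2 * φ s ≤ g s := by
    intro s hs
    have h1 := hφ 0 (by norm_num) s ⟨by linarith [hs.1], hs.2⟩ hs.1 (by linarith [hs.2])
    have h2 := hφ (-s) ⟨by linarith [hs.2], by linarith [hs.1]⟩ 0 (by norm_num)
      (by linarith [hs.1]) (by linarith [hs.2])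
    rw [sub_zero] at h1
    rw [zero_sub, neg_neg] at h2
    simp only [hg]; linarith
  have hg4 : ∀ s ∈ Icc (0 : ℝ) 1, 4 * φ (s / 2) ≤ g s := by
    intro s hs
    have hs0 := hs.1
    have hs1 := hs.2
    have h1 := hφ 0 (by norm_num) (s / 2) ⟨by linarith, by linarith⟩ (by linarith) (by linarith)
    have h2 := hφ (s / 2) ⟨by linarith, by linarith⟩ s ⟨by linarith, by linarith⟩ (by linarith)
      (by linarith)
    have h3 := hφ (-(s / 2)) ⟨by linarith, by linarith⟩ 0 (by norm_num) (by linarith) (by linarith)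
    have h4 := hφ (-s) ⟨by linarith, by linarith⟩ (-(s / 2)) ⟨by linarith, by linarith⟩
      (by linarith) (by linarith)
    rw [show s / 2 - 0 = s / 2 by ring] at h1
    rw [show s - s / 2 = s / 2 by ring] at h2
    rw [show 0 - -(s / 2) = s / 2 by ring] at h3
    rw [show -(s / 2) - -s = s / 2 by ring] at h4
    simp only [hg]; linarith
  have hcheb := two_div_pi_mul_integral_le hgc.continuousOn hgm
  have hgain := integral_half_wave_gain hc hm h0
  set P := ∫ t in (0 : ℝ)..(1 / 2), g (dither t) * dither t with hP
  set N := ∫ t in (0 : ℝ)..(1 / 2), g (dither t) with hN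
  set Φ := ∫ t in (0 : ℝ)..(1 / 2), φ (dither t) with hΦ
  have i1 : IntervalIntegrable (fun t => φ (dither t) * dither t) MeasureTheory.volume 0 (1 / 2) :=
    (intervalIntegrable_comp_dither hc le_rfl (by norm_num) le_rfl).mul_continuousOn hu.continuousOn
  have i2 : IntervalIntegrable (fun t => φ (dither t / 2) * dither t) MeasureTheory.volume
      0 (1 / 2) :=
    intervalIntegrable_comp_dither (φ := fun s => φ (s / 2) * s)
      ((hc.comp (by fun_prop) fun s hs => ⟨by linarith [hs.1], by linarith [hs.2]⟩).mul
        continuousOn_id) le_rfl (by norm_num) le_rfl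
  have i3 : IntervalIntegrable (fun t => g (dither t) * dither t) MeasureTheory.volume 0 (1 / 2) :=
    (hgu.mul hu).intervalIntegrable _ _
  have hPΦ : 2 * (1.03 * (2 / Real.pi) * Φ) ≤ P := by
    -- average the two lower bounds for `g` with weights `0.95` and `0.05`
    have h1 : 1.9 * (∫ t in (0 : ℝ)..(1 / 2), φ (dither t) * dither t)
        + 0.2 * (∫ t in (0 : ℝ)..(1 / 2), φ (dither t / 2) * dither t) ≤ P := by
      rw [← intervalIntegral.integral_const_mul, ← intervalIntegral.integral_const_mul,
        ← intervalIntegral.integral_add (i1.const_mul _) (i2.const_mul _)]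
      refine intervalIntegral.integral_mono_on (by norm_num)
        ((i1.const_mul _).add (i2.const_mul _)) i3 fun t ht => ?_
      have hd := dither_mem_Icc_zero_one ht
      have : 1.9 * φ (dither t) + 0.2 * φ (dither t / 2) ≤ g (dither t) := by
        linarith [hg2 _ hd, hg4 _ hd]
      calc _ = (1.9 * φ (dither t) + 0.2 * φ (dither t / 2)) * dither t := by ring
        _ ≤ _ := mul_le_mul_of_nonneg_right this hd.1
    linarith
  have hq : 2 / Real.pi = 2 * (1 / Real.pi) := by ring
  rw [hq] at hPΦ hcheb
  set q := 1 / Real.pi with hqd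
  have hqpi : q * Real.pi = 1 := by rw [hqd]; field_simp
  have hq1 : 0.3 < q := by rw [hqd, lt_div_iff₀ hpp]; linarith
  have hq2 : q < 0.4 := by rw [hqd, div_lt_iff₀ hpp]; linarith
  have hPA : 2.06 * (q * A) + 2.06 * (q * b) ≤ P := by
    have : q * (A + b) ≤ q * (2 * Φ) := mul_le_mul_of_nonneg_left hAb (by linarith)
    linarith
  have hqA : 0 ≤ q * A := mul_nonneg (by linarith) hA
  have hqb : 0.3 * b ≤ q * b := mul_le_mul_of_nonneg_right hq1.le hb.le
  have hAq : A ≤ 3.15 * (q * A) := by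
    have : q * A * Real.pi = A := by rw [mul_right_comm, hqpi, one_mul]
    have := mul_le_mul_of_nonneg_left hpi'.le hqA
    linarith
  have hNP : N ≤ 1.575 * P := by
    have hN0 : 0 ≤ N := by
      refine intervalIntegral.integral_nonneg (by norm_num) fun t ht => ?_
      have hd := dither_mem_Icc_zero_one ht
      have := hg2 _ hd
      have := hm (by norm_num : (0 : ℝ) ∈ Icc (0 : ℝ) 1) hd hd.1
      linarith
    have : q * N * Real.pi = N := by rw [mul_right_comm, hqpi, one_mul]
    have := mul_le_mul_of_nonneg_left hpi'.le (mul_nonneg (by linarith : 0 ≤ q) hN0)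
    linarith
  -- the drift of `H` differs from that of `F` by at most `2 A / π`
  have hD : P - 2 * (q * A) ≤ ∫ t in (0 : ℝ)..1, H (dither t) * dither t := by
    rw [integral_comp_dither (f := fun s => H s * s) (hH.mul continuous_id), hP, hqd,
      ← integral_dither_half, mul_comm (∫ t in (0 : ℝ)..(1 / 2), dither t), ← mul_assoc,
      ← intervalIntegral.integral_const_mul, ← intervalIntegral.integral_sub i3
        ((hu.intervalIntegrable _ _).const_mul _)]
    refine intervalIntegral.integral_mono_on (by norm_num)
      (i3.sub ((hu.intervalIntegrable _ _).const_mul _))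
      (Continuous.intervalIntegrable (((hH.comp hu).mul hu).add
        ((hH.comp hu.neg).mul hu.neg)) _ _) fun t ht => ?_
    have hd := dither_mem_Icc_zero_one ht
    have h1 := abs_le.1 (hHF (dither t) ⟨by linarith [hd.1], hd.2⟩)
    have h2 := abs_le.1 (hHF (-dither t) ⟨by linarith [hd.2], by linarith [hd.1]⟩)
    have : g (dither t) - 2 * A ≤ H (dither t) - H (-dither t) := by
      simp only [hg]; linarith
    have := mul_le_mul_of_nonneg_right this hd.1
    linarith
  have hM : (∫ t in (0 : ℝ)..1, |H (dither t) - ∫ s in (0 : ℝ)..1, H (dither s)|)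
      ≤ 2 * (N + A) := by
    refine (integral_abs_sub_mean_le (f := fun t => H (dither t)) (hH.comp hu) (F 0)).trans ?_
    apply mul_le_mul_of_nonneg_left _ zero_le_two
    rw [integral_comp_dither (f := fun s => |H s - F 0|) (by fun_prop)]
    calc _ ≤ ∫ t in (0 : ℝ)..(1 / 2), (g (dither t) + 2 * A) := by
          refine intervalIntegral.integral_mono_on (by norm_num)
            (Continuous.intervalIntegrable (by fun_prop) _ _)
            (Continuous.intervalIntegrable (by fun_prop) _ _) fun t ht => ?_
          have hd := dither_mem_Icc_zero_one ht
          have m1 : dither t ∈ Icc (-1 : ℝ) 1 := ⟨by linarith [hd.1], hd.2⟩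
          have m2 : -dither t ∈ Icc (-1 : ℝ) 1 := ⟨by linarith [hd.2], by linarith [hd.1]⟩
          have m0 : (0 : ℝ) ∈ Icc (-1 : ℝ) 1 := by norm_num
          have h1 := abs_le.1 (hHF _ m1)
          have h2 := abs_le.1 (hHF _ m2)
          have h3 := hFm m0 m1 hd.1
          have h4 := hFm m2 m0 (by linarith [hd.1])
          have h5 : |H (dither t) - F 0| ≤ F (dither t) - F 0 + A := by
            rw [abs_le]; constructor <;> linarith
          have h6 : |H (-dither t) - F 0| ≤ F 0 - F (-dither t) + A := by
            rw [abs_le]; constructor <;> linarith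
          simp only [hg]; linarith
      _ = N + A := by
          rw [intervalIntegral.integral_add (hgu.intervalIntegrable _ _) intervalIntegrable_const,
            intervalIntegral.integral_const, smul_eq_mul]
          ring
  constructor
  · linarith
  · linarith

/-- A continuous function that is bounded below and whose increments to the right of `xs` are
bounded below by a class `K_∞` function increases there. -/
theorem strictMonoOn_of_growth {m α : ℝ → ℝ} {xs c : ℝ} (hm : Continuous m)
    (hα : ClassKInfty α) (hc : ∀ x, c ≤ m x)
    (hg : ∀ x₁ x₂, xs ≤ x₁ → xs ≤ x₂ → α |x₂ - x₁| ≤ |m x₂ - m x₁|) :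
    StrictMonoOn m (Ici xs) := by
  have hinj : InjOn m (Ici xs) := by
    intro x hx y hy hxy
    by_contra hne
    have h1 := hg x y hx hy
    rw [hxy, sub_self, abs_zero] at h1
    have h2 : 0 < |y - x| := abs_pos.2 (sub_ne_zero.2 (Ne.symm hne))
    have h3 := hα.strictMonoOn (a := 0) (b := |y - x|) (by simp) h2.le h2
    rw [hα.map_zero] at h3
    linarith
  intro a ha b hb hab
  have ha' : xs ≤ a := ha
  -- far to the right of `a` the value of `m` exceeds `m a`
  obtain ⟨r, hr1, hr2⟩ : ∃ r, m a - c < α r ∧ b - a ≤ r :=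
    ((hα.tendsto_atTop.eventually_gt_atTop (m a - c)).and (eventually_ge_atTop (b - a))).exists
  have hr0 : 0 < r := by linarith
  have hle : m a ≤ m (a + r) := by
    by_contra hlt
    push Not at hlt
    have h1 := hg a (a + r) ha' (by linarith)
    rw [add_sub_cancel_left, abs_of_pos hr0, abs_of_neg (by linarith)] at h1
    linarith [hc (a + r)]
  exact ContinuousOn.strictMonoOn_of_injOn_Icc (by linarith : a ≤ a + r) hle hm.continuousOn
    (hinj.mono fun x hx => ha'.trans hx.1) ⟨le_rfl, by linarith⟩ ⟨hab.le, by linarith⟩ hab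

theorem abs_sub_le_of_lipschitz {h : ℝ → ℝ} {L : ℝ≥0} (hL : LipschitzWith L h) (x y : ℝ) :
    |h x - h y| ≤ L * |x - y| := by
  simpa [Real.dist_eq] using hL.dist_le_mul x y

/-- Away from the minimiser the averaged drift points towards it, is bounded away from zero, and
dominates the oscillation of the output. This is the one-sided version. -/
theorem drift_right {h m α : ℝ → ℝ} {xs c A b δ x : ℝ} (hh : Continuous h) (hm : Continuous m)
    (hα : ClassKInfty α) (hc : ∀ x, c ≤ m x) (hA : 0 ≤ A) (hhm : ∀ x, |h x - m x| ≤ A)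
    (hg : ∀ x₁ x₂, xs ≤ x₁ → xs ≤ x₂ → α |x₂ - x₁| ≤ |m x₂ - m x₁|)
    (hδ : 0 < δ) (hb : 0 < b) (hAb : A + b ≤ deltaStar α δ) (hx : xs + δ ≤ x) :
    b / 2 ≤ averagedDrift h δ x ∧ oscillation h δ x ≤ 220 * averagedDrift h δ x := by
  have hmono := strictMonoOn_of_growth hm hα hc hg
  have hmem : ∀ s ∈ Icc (-1 : ℝ) 1, x + δ * s ∈ Ici xs := by
    intro s hs
    have := mul_le_mul_of_nonneg_left hs.1 hδ.le
    simp only [mem_Ici]; linarith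
  refine drift_of_near_monotone (F := fun s => m (x + δ * s)) (H := fun s => h (x + δ * s))
    (φ := fun s => α (δ * s)) (A := A) (by fun_prop) (by fun_prop) ?_ (fun s _ => hhm _) ?_ ?_ ?_ ?_
    hA hb hAb
  · intro s hs r hr hsr
    exact hmono.monotoneOn (hmem s hs) (hmem r hr)
      (by linarith [mul_le_mul_of_nonneg_left hsr hδ.le])
  · exact hα.continuousOn.comp (by fun_prop) fun s hs => mul_nonneg hδ.le hs.1
  · intro s hs r hr hsr
    exact hα.strictMonoOn.monotoneOn (mul_nonneg hδ.le hs.1) (mul_nonneg hδ.le hr.1)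
      (mul_le_mul_of_nonneg_left hsr hδ.le)
  · simp [hα.map_zero]
  · intro s hs r hr hsr _
    have h1 := hg _ _ (hmem s hs) (hmem r hr)
    have h2 : m (x + δ * s) ≤ m (x + δ * r) := hmono.monotoneOn (hmem s hs) (hmem r hr)
      (by linarith [mul_le_mul_of_nonneg_left hsr hδ.le])
    rw [show x + δ * r - (x + δ * s) = δ * (r - s) by ring,
      abs_of_nonneg (mul_nonneg hδ.le (sub_nonneg.2 hsr)), abs_of_nonneg (sub_nonneg.2 h2)] at h1
    exact h1

theorem integral_comp_one_sub (f : ℝ → ℝ) :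
    ∫ t in (0 : ℝ)..1, f (1 - t) = ∫ t in (0 : ℝ)..1, f t := by
  rw [intervalIntegral.integral_comp_sub_left f 1]
  norm_num

theorem output_comp_neg (h : ℝ → ℝ) (δ x t : ℝ) :
    output (fun z => h (-z)) δ (-x) t = output h δ x (1 - t) := by
  simp only [output, dither_one_sub]
  congr 1
  ring

theorem meanOutput_comp_neg (h : ℝ → ℝ) (δ x : ℝ) :
    meanOutput (fun z => h (-z)) δ (-x) = meanOutput h δ x := by
  simp only [meanOutput, output_comp_neg]
  exact integral_comp_one_sub (fun t => output h δ x t)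

theorem averagedDrift_comp_neg (h : ℝ → ℝ) (δ x : ℝ) :
    averagedDrift (fun z => h (-z)) δ (-x) = -averagedDrift h δ x := by
  simp only [averagedDrift, output_comp_neg]
  rw [← integral_comp_one_sub (fun t => output h δ x t * dither t),
    ← intervalIntegral.integral_neg]
  simp only [dither_one_sub, mul_neg, neg_neg]

theorem oscillation_comp_neg (h : ℝ → ℝ) (δ x : ℝ) :
    oscillation (fun z => h (-z)) δ (-x) = oscillation h δ x := by
  simp only [oscillation, output_comp_neg, meanOutput_comp_neg]
  exact integral_comp_one_sub (fun t => |output h δ x t - meanOutput h δ x|)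

/-- Away from the minimiser the averaged drift points towards it, is bounded away from zero, and
dominates the oscillation of the output. -/
theorem drift_of_approx {h m α : ℝ → ℝ} {xs A b δ : ℝ} (hh : SmoothWithMinimiser h xs)
    (hq : QuasiconvexApprox h xs m α A) (hδ : 0 < δ) (hb : 0 < b) (hAb : A + b ≤ deltaStar α δ)
    {x : ℝ} (hx : δ ≤ |x - xs|) :
    b / 2 ≤ |averagedDrift h δ x| ∧ oscillation h δ x ≤ 220 * |averagedDrift h δ x| ∧
      0 ≤ (x - xs) * averagedDrift h δ x := by
  have hhc : Continuous h := hh.smooth.continuous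
  have hmc : Continuous m := hq.locallyLipschitz.continuous
  have hhm : ∀ x, |h x - m x| ≤ A := fun x => by
    rw [abs_le]; constructor <;> linarith [hq.lower x, hq.upper x]
  have hmin : ∀ x, h xs - A ≤ m x := fun x => by
    rcases eq_or_ne x xs with rfl | hne
    · linarith [hq.upper x]
    · linarith [hq.upper x, hh.minimiser x hne]
  rcases le_abs.1 hx with hx | hx
  · obtain ⟨h1, h2⟩ := drift_right (x := x) hhc hmc hq.classKInfty hmin hq.nonneg hhm
      (fun x₁ x₂ h₁ h₂ => hq.growth x₁ x₂ (mul_nonneg (sub_nonneg.2 h₁) (sub_nonneg.2 h₂)))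
      hδ hb hAb (by linarith)
    rw [abs_of_nonneg (by linarith)]
    exact ⟨h1, h2, mul_nonneg (by linarith) (by linarith)⟩
  · obtain ⟨h1, h2⟩ := drift_right (h := fun z => h (-z)) (m := fun z => m (-z)) (xs := -xs)
      (x := -x) (by fun_prop) (by fun_prop) hq.classKInfty (fun x => hmin (-x)) hq.nonneg
      (fun x => hhm (-x))
      (fun x₁ x₂ h₁ h₂ => by
        have := hq.growth (-x₁) (-x₂) (mul_nonneg_of_nonpos_of_nonpos (by linarith) (by linarith))
        rwa [show -x₂ - -x₁ = -(x₂ - x₁) by ring, abs_neg] at this)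
      hδ hb hAb (by linarith)
    rw [averagedDrift_comp_neg] at h1 h2
    rw [oscillation_comp_neg] at h2
    rw [abs_of_nonpos (by linarith)]
    exact ⟨h1, h2, mul_nonneg_of_nonpos_of_nonpos (by linarith) (by linarith)⟩

/-! ### Lipschitz bounds on averages of the output -/

theorem continuous_output {h : ℝ → ℝ} (hh : Continuous h) (δ x : ℝ) :
    Continuous (output h δ x) := by
  have := continuous_dither
  unfold output; fun_prop

theorem fourierCos_zero_div_two (h : ℝ → ℝ) (δ x : ℝ) :
    fourierCos h δ 0 x / 2 = meanOutput h δ x := by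
  simp [fourierCos, meanOutput]

theorem abs_output_sub_output_le {h : ℝ → ℝ} {L : ℝ≥0} (hL : LipschitzWith L h) (δ x x' t : ℝ) :
    |output h δ x t - output h δ x' t| ≤ L * |x - x'| := by
  have := abs_sub_le_of_lipschitz hL (x + δ * dither t) (x' + δ * dither t)
  rwa [add_sub_add_right_eq_sub] at this

theorem abs_output_sub_le {h : ℝ → ℝ} {L : ℝ≥0} (hL : LipschitzWith L h) {δ : ℝ} (hδ : 0 ≤ δ)
    (x t : ℝ) : |output h δ x t - h x| ≤ L * δ := by
  have h1 := abs_sub_le_of_lipschitz hL (x + δ * dither t) x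
  rw [add_sub_cancel_left, abs_mul, abs_of_nonneg hδ] at h1
  refine h1.trans (mul_le_mul_of_nonneg_left ?_ L.coe_nonneg)
  exact mul_le_of_le_one_right hδ (abs_dither_le_one t)

theorem integral_abs_le_of_abs_le {f : ℝ → ℝ} (hf : Continuous f) {c : ℝ} (hc : ∀ t, |f t| ≤ c) :
    ∫ t in (0 : ℝ)..1, |f t| ≤ c := by
  calc ∫ t in (0 : ℝ)..1, |f t| ≤ ∫ _ in (0 : ℝ)..1, c :=
        intervalIntegral.integral_mono_on zero_le_one (hf.abs.intervalIntegrable _ _)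
          intervalIntegrable_const fun t _ => hc t
    _ = c := by simp

theorem abs_meanOutput_sub_meanOutput_le {h : ℝ → ℝ} {L : ℝ≥0} (hL : LipschitzWith L h)
    (δ x x' : ℝ) : |meanOutput h δ x - meanOutput h δ x'| ≤ L * |x - x'| := by
  have c := continuous_output hL.continuous δ x
  have c' := continuous_output hL.continuous δ x'
  unfold meanOutput
  rw [← intervalIntegral.integral_sub (c.intervalIntegrable _ _) (c'.intervalIntegrable _ _)]
  exact (intervalIntegral.abs_integral_le_integral_abs zero_le_one).trans
    (integral_abs_le_of_abs_le (c.sub c') fun t => abs_output_sub_output_le hL δ x x' t)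

theorem oscillation_le {h : ℝ → ℝ} {L : ℝ≥0} (hL : LipschitzWith L h) {δ : ℝ} (hδ : 0 ≤ δ)
    (x : ℝ) : oscillation h δ x ≤ 2 * (L * δ) := by
  have c := continuous_output hL.continuous δ x
  refine (integral_abs_sub_mean_le c (h x)).trans ?_
  exact mul_le_mul_of_nonneg_left
    (integral_abs_le_of_abs_le (f := fun t => output h δ x t - h x) (c.sub continuous_const)
      fun t => abs_output_sub_le hL hδ x t) zero_le_two

theorem oscillation_nonneg (h : ℝ → ℝ) (δ x : ℝ) : 0 ≤ oscillation h δ x :=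
  intervalIntegral.integral_nonneg zero_le_one fun _ _ => abs_nonneg _

/-- The dither has mean zero, so subtracting a constant from the output leaves the averaged drift
unchanged. -/
theorem integral_output_sub_mul_dither {h : ℝ → ℝ} (hh : Continuous h) (δ x c : ℝ) :
    ∫ t in (0 : ℝ)..1, (output h δ x t - c) * dither t = averagedDrift h δ x := by
  have ho := continuous_output hh δ x
  have hu := continuous_dither
  have hi : IntervalIntegrable (fun t => output h δ x t * dither t) MeasureTheory.volume 0 1 :=
    (ho.mul hu).intervalIntegrable _ _
  simp only [sub_mul]
  rw [intervalIntegral.integral_sub hi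
    ((hu.intervalIntegrable _ _).const_mul _), intervalIntegral.integral_const_mul,
    integral_dither_period, mul_zero, sub_zero, averagedDrift]

theorem abs_averagedDrift_le {h : ℝ → ℝ} {L : ℝ≥0} (hL : LipschitzWith L h) {δ : ℝ} (hδ : 0 ≤ δ)
    (x : ℝ) : |averagedDrift h δ x| ≤ L * δ := by
  have ho := continuous_output hL.continuous δ x
  rw [← integral_output_sub_mul_dither hL.continuous δ x (h x)]
  refine (intervalIntegral.abs_integral_le_integral_abs zero_le_one).trans ?_
  refine integral_abs_le_of_abs_le (f := fun t => (output h δ x t - h x) * dither t)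
    ((ho.sub continuous_const).mul continuous_dither) fun t => ?_
  rw [abs_mul]
  exact (mul_le_of_le_one_right (abs_nonneg _) (abs_dither_le_one t)).trans
    (abs_output_sub_le hL hδ x t)

theorem integral_abs_output_sub_le {h : ℝ → ℝ} (hh : Continuous h) (δ x y : ℝ) :
    ∫ t in (0 : ℝ)..1, |output h δ x t - y| ≤ oscillation h δ x + |y - meanOutput h δ x| := by
  have ho := continuous_output hh δ x
  have hi : IntervalIntegrable (fun t => |output h δ x t - meanOutput h δ x|)
      MeasureTheory.volume 0 1 := (ho.sub continuous_const).abs.intervalIntegrable _ _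
  calc ∫ t in (0 : ℝ)..1, |output h δ x t - y|
      ≤ ∫ t in (0 : ℝ)..1, (|output h δ x t - meanOutput h δ x| + |y - meanOutput h δ x|) := by
        refine intervalIntegral.integral_mono_on zero_le_one
          ((ho.sub continuous_const).abs.intervalIntegrable _ _)
          (hi.add intervalIntegrable_const) fun t _ => ?_
        rw [abs_sub_comm y]
        exact abs_sub_le _ _ _
    _ = _ := by
        rw [intervalIntegral.integral_add hi intervalIntegrable_const,
          intervalIntegral.integral_const]
        simp [oscillation]

/-! ### Trajectories over one period -/

namespace IsTrajectory

variable {h x y : ℝ → ℝ} {γ δ x₀ y₀ : ℝ}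

theorem continuousOn_x (ht : IsTrajectory h γ δ x₀ y₀ x y) : ContinuousOn x (Ici 0) :=
  fun t h0 => (ht.deriv_x t h0).continuousWithinAt

theorem continuousOn_y (ht : IsTrajectory h γ δ x₀ y₀ x y) : ContinuousOn y (Ici 0) :=
  fun t h0 => (ht.deriv_y t h0).continuousWithinAt

theorem continuousOn_error (hh : Continuous h) (ht : IsTrajectory h γ δ x₀ y₀ x y) :
    ContinuousOn (fun t => output h δ (x t) t - y t) (Ici 0) := by
  have := continuous_dither
  refine ContinuousOn.sub ?_ ht.continuousOn_y
  exact hh.comp_continuousOn (ht.continuousOn_x.add (by fun_prop))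

theorem sub_eq_integral_x (hh : Continuous h) (ht : IsTrajectory h γ δ x₀ y₀ x y) {s : ℝ}
    (hs : 0 ≤ s) :
    x s - x₀ = -γ * ∫ t in (0 : ℝ)..s, (output h δ (x t) t - y t) * dither t := by
  have hsub : Icc 0 s ⊆ Ici (0 : ℝ) := fun t ht => ht.1
  have hi : IntervalIntegrable (fun t => -γ * (output h δ (x t) t - y t) * dither t)
      MeasureTheory.volume 0 s :=
    ContinuousOn.intervalIntegrable_of_Icc hs ((continuousOn_const.mul
      ((ht.continuousOn_error hh).mono hsub)).mul continuous_dither.continuousOn)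
  rw [← ht.init_x, ← intervalIntegral.integral_eq_sub_of_hasDerivAt_of_le hs
    (ht.continuousOn_x.mono hsub)
    (fun t h0 => (ht.deriv_x t h0.1.le).hasDerivAt (Ici_mem_nhds h0.1)) hi,
    ← intervalIntegral.integral_const_mul]
  simp only [mul_assoc]

theorem sub_eq_integral_y (hh : Continuous h) (ht : IsTrajectory h γ δ x₀ y₀ x y) {s : ℝ}
    (hs : 0 ≤ s) :
    y s - y₀ = γ * ∫ t in (0 : ℝ)..s, (output h δ (x t) t - y t) := by
  have hsub : Icc 0 s ⊆ Ici (0 : ℝ) := fun t ht => ht.1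
  have hi : IntervalIntegrable (fun t => γ * (output h δ (x t) t - y t))
      MeasureTheory.volume 0 s :=
    ContinuousOn.intervalIntegrable_of_Icc hs (continuousOn_const.mul
      ((ht.continuousOn_error hh).mono hsub))
  rw [← ht.init_y, ← intervalIntegral.integral_eq_sub_of_hasDerivAt_of_le hs
    (ht.continuousOn_y.mono hsub)
    (fun t h0 => (ht.deriv_y t h0.1.le).hasDerivAt (Ici_mem_nhds h0.1)) hi,
    ← intervalIntegral.integral_const_mul]

/-- Restarting a trajectory after `n` periods gives a trajectory. -/
theorem shift (ht : IsTrajectory h γ δ x₀ y₀ x y) (n : ℕ) :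
    IsTrajectory h γ δ (x n) (y n) (fun t => x (n + t)) (fun t => y (n + t)) := by
  have key : ∀ {f : ℝ → ℝ} {f' : ℝ} (t : ℝ), 0 ≤ t →
      HasDerivWithinAt f f' (Ici 0) (n + t) →
      HasDerivWithinAt (fun t => f (n + t)) f' (Ici 0) t := by
    intro f f' t _ hf
    have h1 : HasDerivWithinAt (fun t : ℝ => (n : ℝ) + t) 1 (Ici 0) t :=
      ((hasDerivAt_id t).const_add _).hasDerivWithinAt
    have := HasDerivWithinAt.comp (s' := Ici 0) t hf h1
      (fun s hs => add_nonneg (Nat.cast_nonneg n) (mem_Ici.1 hs))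
    rw [mul_one] at this
    exact this
  have hout : ∀ t, output h δ (x (n + t)) t = output h δ (x (n + t)) (n + t) := by
    intro t; simp only [output, dither_nat_add]
  refine ⟨by simp, by simp, fun t h0 => ?_, fun t h0 => ?_⟩
  · rw [hout, ← dither_nat_add n t]
    exact key t h0 (ht.deriv_x _ (by positivity))
  · rw [hout]
    exact key t h0 (ht.deriv_y _ (by positivity))

/-- Over one period the trajectory follows the averaged dynamics, up to an error of second order in
`γ` that is proportional to the mean size of the filtered output. This proportionality, rather
than a uniform bound, is what allows `γ` to be chosen independently of the size of the drift. -/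
theorem period_estimate {L : ℝ≥0} (hL : LipschitzWith L h) (hγ : 0 ≤ γ) (hγL : (L + 1) * γ ≤ 1 / 2)
    (ht : IsTrajectory h γ δ x₀ y₀ x y) :
    |x 1 - x₀ + γ * averagedDrift h δ x₀|
        ≤ 2 * (L + 1) * γ ^ 2 * (oscillation h δ x₀ + |y₀ - meanOutput h δ x₀|) ∧
    |y 1 - y₀ + γ * (y₀ - meanOutput h δ x₀)|
        ≤ 2 * (L + 1) * γ ^ 2 * (oscillation h δ x₀ + |y₀ - meanOutput h δ x₀|) ∧
    ∀ s ∈ Icc (0 : ℝ) 1,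
      |x s - x₀| ≤ 2 * γ * (oscillation h δ x₀ + |y₀ - meanOutput h δ x₀|) ∧
      |y s - y₀| ≤ 2 * γ * (oscillation h δ x₀ + |y₀ - meanOutput h δ x₀|) := by
  have hh := hL.continuous
  have hu := continuous_dither
  set e : ℝ → ℝ := fun t => output h δ (x t) t - y t with he
  set e₀ : ℝ → ℝ := fun t => output h δ x₀ t - y₀ with he₀
  have hec : ContinuousOn e (Icc 0 1) := (ht.continuousOn_error hh).mono fun t h => h.1
  have he₀c : Continuous e₀ := (continuous_output hh δ x₀).sub continuous_const
  have hei : IntervalIntegrable e MeasureTheory.volume 0 1 :=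
    hec.intervalIntegrable_of_Icc zero_le_one
  have he₀i : IntervalIntegrable e₀ MeasureTheory.volume 0 1 := he₀c.intervalIntegrable _ _
  set I := ∫ t in (0 : ℝ)..1, |e t| with hI
  set I₀ := ∫ t in (0 : ℝ)..1, |e₀ t| with hI₀
  have hI₀le : I₀ ≤ oscillation h δ x₀ + |y₀ - meanOutput h δ x₀| :=
    integral_abs_output_sub_le hh δ x₀ y₀
  have hpart : ∀ s ∈ Icc (0 : ℝ) 1, ∫ t in (0 : ℝ)..s, |e t| ≤ I := by
    intro s hs
    refine intervalIntegral.integral_mono_interval le_rfl hs.1 hs.2 ?_ hei.abs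
    exact Filter.Eventually.of_forall fun t => abs_nonneg _
  have hx : ∀ s ∈ Icc (0 : ℝ) 1, |x s - x₀| ≤ γ * I := by
    intro s hs
    have hcs : ContinuousOn e (Icc 0 s) := hec.mono (Icc_subset_Icc le_rfl hs.2)
    rw [ht.sub_eq_integral_x hh hs.1, abs_mul, abs_neg, abs_of_nonneg hγ]
    refine mul_le_mul_of_nonneg_left ?_ hγ
    refine (intervalIntegral.abs_integral_le_integral_abs hs.1).trans (le_trans ?_ (hpart s hs))
    refine intervalIntegral.integral_mono_on hs.1
      ((hcs.mul hu.continuousOn).abs.intervalIntegrable_of_Icc hs.1)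
      (hcs.abs.intervalIntegrable_of_Icc hs.1) fun t _ => ?_
    rw [abs_mul]
    exact mul_le_of_le_one_right (abs_nonneg _) (abs_dither_le_one t)
  have hy : ∀ s ∈ Icc (0 : ℝ) 1, |y s - y₀| ≤ γ * I := by
    intro s hs
    rw [ht.sub_eq_integral_y hh hs.1, abs_mul, abs_of_nonneg hγ]
    exact mul_le_mul_of_nonneg_left
      ((intervalIntegral.abs_integral_le_integral_abs hs.1).trans (hpart s hs)) hγ
  have hdiff : ∀ t ∈ Icc (0 : ℝ) 1, |e t - e₀ t| ≤ (L + 1) * γ * I := by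
    intro t h1
    have h2 := abs_output_sub_output_le hL δ (x t) x₀ t
    have h3 := mul_le_mul_of_nonneg_left (hx t h1) L.coe_nonneg
    have h4 := hy t h1
    have h5 : e t - e₀ t = (output h δ (x t) t - output h δ x₀ t) - (y t - y₀) := by
      simp only [he, he₀]; ring
    rw [h5]
    refine (abs_sub _ _).trans ?_
    linarith
  have hII : I ≤ 2 * I₀ := by
    have : I ≤ ∫ t in (0 : ℝ)..1, (|e₀ t| + (L + 1) * γ * I) := by
      refine intervalIntegral.integral_mono_on zero_le_one hei.abs
        (he₀i.abs.add intervalIntegrable_const) fun t h1 => ?_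
      have h2 := hdiff t h1
      have h3 : |e t| ≤ |e₀ t| + |e t - e₀ t| := by
        have := abs_add_le (e₀ t) (e t - e₀ t)
        rwa [add_sub_cancel] at this
      linarith
    rw [intervalIntegral.integral_add he₀i.abs intervalIntegrable_const,
      intervalIntegral.integral_const, smul_eq_mul] at this
    have hI0 : 0 ≤ I := intervalIntegral.integral_nonneg zero_le_one fun _ _ => abs_nonneg _
    have := mul_le_mul_of_nonneg_right hγL hI0
    linarith
  have hB : (0 : ℝ) ≤ oscillation h δ x₀ + |y₀ - meanOutput h δ x₀| :=
    add_nonneg (oscillation_nonneg _ _ _) (abs_nonneg _)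
  have hIB : I ≤ 2 * (oscillation h δ x₀ + |y₀ - meanOutput h δ x₀|) := by linarith
  have hγI : γ * I ≤ 2 * γ * (oscillation h δ x₀ + |y₀ - meanOutput h δ x₀|) := by
    linarith [mul_le_mul_of_nonneg_left hIB hγ]
  have herr : γ * ((L + 1) * γ * I)
      ≤ 2 * (L + 1) * γ ^ 2 * (oscillation h δ x₀ + |y₀ - meanOutput h δ x₀|) := by
    have : 0 ≤ (L + 1 : ℝ) * γ ^ 2 := by positivity
    linarith [mul_le_mul_of_nonneg_left hIB this]
  have hL1 : (0 : ℝ) ≤ (L + 1) * γ * I := (abs_nonneg _).trans (hdiff 0 (by norm_num))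
  refine ⟨?_, ?_, fun s hs => ⟨(hx s hs).trans hγI, (hy s hs).trans hγI⟩⟩
  · have h1 : x 1 - x₀ + γ * averagedDrift h δ x₀
        = -(γ * ∫ t in (0 : ℝ)..1, (e t - e₀ t) * dither t) := by
      rw [ht.sub_eq_integral_x hh zero_le_one, ← integral_output_sub_mul_dither hh δ x₀ y₀]
      have hi : IntervalIntegrable (fun t => e t * dither t) MeasureTheory.volume 0 1 :=
        (hec.mul hu.continuousOn).intervalIntegrable_of_Icc zero_le_one
      have hi₀ : IntervalIntegrable (fun t => e₀ t * dither t) MeasureTheory.volume 0 1 :=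
        (he₀c.mul hu).intervalIntegrable _ _
      simp only [sub_mul (e _)]
      rw [intervalIntegral.integral_sub hi hi₀]
      ring
    rw [h1, abs_neg, abs_mul, abs_of_nonneg hγ]
    refine le_trans (mul_le_mul_of_nonneg_left ?_ hγ) herr
    have := intervalIntegral.norm_integral_le_of_norm_le_const (a := (0 : ℝ)) (b := 1)
      (f := fun t => (e t - e₀ t) * dither t) (C := (L + 1) * γ * I) fun t h2 => by
        rw [uIoc_of_le zero_le_one] at h2
        rw [Real.norm_eq_abs, abs_mul]
        exact (mul_le_of_le_one_right (abs_nonneg _) (abs_dither_le_one t)).trans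
          (hdiff t ⟨h2.1.le, h2.2⟩)
    simpa using this
  · have h0 : ∫ t in (0 : ℝ)..1, e₀ t = meanOutput h δ x₀ - y₀ := by
      simp only [he₀]
      rw [intervalIntegral.integral_sub ((continuous_output hh δ x₀).intervalIntegrable _ _)
        intervalIntegrable_const, intervalIntegral.integral_const]
      simp [meanOutput]
    have h1 : y 1 - y₀ + γ * (y₀ - meanOutput h δ x₀)
        = γ * ∫ t in (0 : ℝ)..1, (e t - e₀ t) := by
      rw [ht.sub_eq_integral_y hh zero_le_one, intervalIntegral.integral_sub hei he₀i, h0]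
      ring
    rw [h1, abs_mul, abs_of_nonneg hγ]
    refine le_trans (mul_le_mul_of_nonneg_left ?_ hγ) herr
    have := intervalIntegral.norm_integral_le_of_norm_le_const (a := (0 : ℝ)) (b := 1)
      (f := fun t => e t - e₀ t) (C := (L + 1) * γ * I) fun t h2 => by
        rw [uIoc_of_le zero_le_one] at h2
        exact hdiff t ⟨h2.1.le, h2.2⟩
    simpa using this

end IsTrajectory

/-! ### Global existence -/

theorem abs_clamp_sub_clamp_le (R a b : ℝ) :
    |max (-R) (min R a) - max (-R) (min R b)| ≤ |a - b| := by
  have h1 := abs_max_sub_max_le_max (-R) (min R a) (-R) (min R b)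
  have h2 := abs_min_sub_min_le_max R a R b
  simp only [sub_self, abs_zero, abs_nonneg, max_eq_right] at h1 h2
  exact h1.trans h2

theorem abs_clamp_le {R : ℝ} (hR : 0 ≤ R) (a : ℝ) : |max (-R) (min R a)| ≤ R := by
  rw [abs_le]
  exact ⟨le_max_left _ _, max_le (by linarith) (min_le_left _ _)⟩

theorem abs_clamp_le_abs {R : ℝ} (hR : 0 ≤ R) (a : ℝ) : |max (-R) (min R a)| ≤ |a| := by
  have h0 : max (-R) (min R 0) = 0 := by rw [min_eq_right hR, max_eq_right (by linarith)]
  simpa [h0] using abs_clamp_sub_clamp_le R a 0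

theorem clamp_eq_self {R a : ℝ} (ha : |a| ≤ R) : max (-R) (min R a) = a := by
  rw [abs_le] at ha
  rw [min_eq_right ha.2, max_eq_right ha.1]

/-- The vector field of the extremum seeking scheme. -/
noncomputable def seekingField (h : ℝ → ℝ) (γ δ t : ℝ) (v : ℝ × ℝ) : ℝ × ℝ :=
  (-γ * (output h δ v.1 t - v.2) * dither t, γ * (output h δ v.1 t - v.2))

/-- Truncation of both coordinates to `[-R, R]`. -/
def clampPair (R : ℝ) (v : ℝ × ℝ) : ℝ × ℝ := (max (-R) (min R v.1), max (-R) (min R v.2))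

theorem norm_clampPair_sub_le (R : ℝ) (v w : ℝ × ℝ) :
    ‖clampPair R v - clampPair R w‖ ≤ ‖v - w‖ :=
  max_le_max (abs_clamp_sub_clamp_le _ _ _) (abs_clamp_sub_clamp_le _ _ _)

section Field

variable {h : ℝ → ℝ} {L : ℝ≥0} {γ δ : ℝ}

theorem norm_seekingField_sub_le (hL : LipschitzWith L h) (hγ : 0 ≤ γ) (t : ℝ) (v w : ℝ × ℝ) :
    ‖seekingField h γ δ t v - seekingField h γ δ t w‖ ≤ γ * (L + 1) * ‖v - w‖ := by
  have h1 := abs_output_sub_output_le hL δ v.1 w.1 t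
  have h2 : |v.1 - w.1| ≤ ‖v - w‖ := le_max_left _ _
  have h3 : |v.2 - w.2| ≤ ‖v - w‖ := le_max_right _ _
  have h4 : |(output h δ v.1 t - output h δ w.1 t) - (v.2 - w.2)| ≤ (L + 1) * ‖v - w‖ := by
    refine (abs_sub _ _).trans ?_
    have := mul_le_mul_of_nonneg_left h2 L.coe_nonneg
    linarith
  have h5 := mul_le_mul_of_nonneg_left h4 hγ
  rw [← mul_assoc] at h5
  refine max_le ?_ ?_
  · have : (seekingField h γ δ t v - seekingField h γ δ t w).1
        = -(γ * ((output h δ v.1 t - output h δ w.1 t) - (v.2 - w.2)) * dither t) := by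
      simp only [seekingField, Prod.fst_sub]; ring
    rw [this, Real.norm_eq_abs, abs_neg, abs_mul, abs_mul, abs_of_nonneg hγ]
    exact (mul_le_of_le_one_right (by positivity) (abs_dither_le_one t)).trans h5
  · have : (seekingField h γ δ t v - seekingField h γ δ t w).2
        = γ * ((output h δ v.1 t - output h δ w.1 t) - (v.2 - w.2)) := by
      simp only [seekingField, Prod.snd_sub]; ring
    rw [this, Real.norm_eq_abs, abs_mul, abs_of_nonneg hγ]
    exact h5

theorem norm_seekingField_zero_le (hL : LipschitzWith L h) (hγ : 0 ≤ γ) (hδ : 0 ≤ δ) (t : ℝ) :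
    ‖seekingField h γ δ t 0‖ ≤ γ * (|h 0| + L * δ) := by
  have h1 := abs_output_sub_le hL hδ 0 t
  have h2 : |output h δ 0 t| ≤ |h 0| + L * δ := by
    have := abs_add_le (h 0) (output h δ 0 t - h 0)
    rw [add_sub_cancel] at this
    linarith
  have h3 := mul_le_mul_of_nonneg_left h2 hγ
  refine max_le ?_ ?_
  · simp only [seekingField, Prod.fst_zero, Prod.snd_zero, sub_zero, Real.norm_eq_abs, abs_mul,
      abs_neg, abs_of_nonneg hγ]
    exact (mul_le_of_le_one_right (by positivity) (abs_dither_le_one t)).trans h3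
  · simp only [seekingField, Prod.fst_zero, Prod.snd_zero, sub_zero, Real.norm_eq_abs, abs_mul,
      abs_of_nonneg hγ]
    exact h3

theorem norm_seekingField_le (hL : LipschitzWith L h) (hγ : 0 ≤ γ) (hδ : 0 ≤ δ) (t : ℝ)
    (v : ℝ × ℝ) : ‖seekingField h γ δ t v‖ ≤ γ * (L + 1) * ‖v‖ + γ * (|h 0| + L * δ) := by
  have h1 := norm_seekingField_sub_le (δ := δ) hL hγ t v 0
  have h2 := norm_seekingField_zero_le hL hγ hδ t
  have h3 := norm_sub_norm_le (seekingField h γ δ t v) (seekingField h γ δ t 0)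
  rw [sub_zero] at h1
  linarith

/-- Existence on a bounded interval: the Picard–Lindelöf theorem applies on the whole interval to
the field truncated outside a large square, and by Grönwall's inequality its solution never leaves
the square. -/
theorem exists_solution_Icc (hL : LipschitzWith L h) (hγ : 0 ≤ γ) (hδ : 0 ≤ δ) (v₀ : ℝ × ℝ)
    {T : ℝ} (hT : 0 ≤ T) :
    ∃ v : ℝ → ℝ × ℝ, v 0 = v₀ ∧
      ∀ t ∈ Icc 0 T, HasDerivWithinAt v (seekingField h γ δ t (v t)) (Icc 0 T) t := by
  set K : ℝ := γ * (L + 1) with hK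
  set c : ℝ := γ * (|h 0| + L * δ) with hc
  have hK0 : 0 ≤ K := by positivity
  have hc0 : 0 ≤ c := by positivity
  set R : ℝ := gronwallBound ‖v₀‖ K c T with hR
  have hR0 : 0 ≤ R := by
    have := gronwallBound_mono (norm_nonneg v₀) hc0 hK0 hT
    rw [gronwallBound_x0] at this
    exact (norm_nonneg _).trans this
  set f : ℝ → ℝ × ℝ → ℝ × ℝ := fun t v => seekingField h γ δ t (clampPair R v) with hf
  have hfle : ∀ t v, ‖f t v‖ ≤ K * ‖v‖ + c := fun t v => by
    refine (norm_seekingField_le hL hγ hδ t _).trans ?_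
    have : ‖clampPair R v‖ ≤ ‖v‖ :=
      max_le_max (abs_clamp_le_abs hR0 _) (abs_clamp_le_abs hR0 _)
    linarith [mul_le_mul_of_nonneg_left this hK0]
  have hfB : ∀ t v, ‖f t v‖ ≤ K * R + c := fun t v => by
    refine (norm_seekingField_le hL hγ hδ t _).trans ?_
    have : ‖clampPair R v‖ ≤ R := max_le (abs_clamp_le hR0 _) (abs_clamp_le hR0 _)
    linarith [mul_le_mul_of_nonneg_left this hK0]
  have hpl : IsPicardLindelof f (tmin := 0) (tmax := T) ⟨0, le_rfl, hT⟩ v₀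
      (Real.toNNReal ((K * R + c) * T)) 0 (Real.toNNReal (K * R + c)) (Real.toNNReal K) := by
    refine ⟨fun t _ => ?_, fun v _ => ?_, fun t _ v _ => ?_, ?_⟩
    · refine (LipschitzWith.of_dist_le_mul fun v w => ?_).lipschitzOnWith
      rw [dist_eq_norm, dist_eq_norm, Real.coe_toNNReal _ hK0]
      exact (norm_seekingField_sub_le hL hγ t _ _).trans
        (mul_le_mul_of_nonneg_left (norm_clampPair_sub_le R v w) hK0)
    · have h1 := continuous_output hL.continuous δ (clampPair R v).1
      have h2 := continuous_dither
      simp only [hf, seekingField]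
      fun_prop
    · rw [Real.coe_toNNReal _ (by positivity)]
      exact hfB t v
    · rw [Real.coe_toNNReal _ (by positivity), Real.coe_toNNReal _ (by positivity)]
      simp [hT]
  obtain ⟨v, hv0, hv⟩ := hpl.exists_eq_forall_mem_Icc_hasDerivWithinAt₀
  have hv0' : v 0 = v₀ := hv0
  refine ⟨v, hv0', fun t ht => ?_⟩
  have hb := norm_le_gronwallBound_of_norm_deriv_right_le (f := v) (f' := fun t => f t (v t))
    (δ := ‖v₀‖) (K := K) (ε := c) (a := 0) (b := T) (fun t ht => (hv t ht).continuousWithinAt)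
    (fun t ht => (hv t ⟨ht.1, ht.2.le⟩).mono_of_mem_nhdsWithin
      (Icc_mem_nhdsGE_of_mem ⟨ht.1, ht.2⟩)) (by rw [hv0']) (fun t _ => hfle t _) t ht
  have hb' : ‖v t‖ ≤ R := hb.trans (gronwallBound_mono (norm_nonneg v₀) hc0 hK0 (by linarith [ht.2]))
  have hclamp : clampPair R (v t) = v t :=
    Prod.ext (clamp_eq_self ((le_max_left _ _).trans hb'))
      (clamp_eq_self ((le_max_right _ _).trans hb'))
  have := hv t ht
  simp only [hf, hclamp] at this
  exact this

/-- Trajectories exist for all positive times: solutions on bounded intervals agree by uniqueness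
and can be glued. -/
theorem exists_isTrajectory (hL : LipschitzWith L h) (hγ : 0 ≤ γ) (hδ : 0 ≤ δ) (x₀ y₀ : ℝ) :
    ∃ x y : ℝ → ℝ, IsTrajectory h γ δ x₀ y₀ x y := by
  choose v hv0 hv using fun n : ℕ =>
    exists_solution_Icc hL hγ hδ (x₀, y₀) (T := (n : ℝ)) (Nat.cast_nonneg n)
  have huniq : ∀ {n k : ℕ}, n ≤ k → EqOn (v n) (v k) (Icc 0 (n : ℝ)) := by
    intro n k hnk
    have hnk' : (n : ℝ) ≤ k := Nat.cast_le.2 hnk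
    refine ODE_solution_unique_of_mem_Icc_right (v := seekingField h γ δ) (s := fun _ => univ)
      (K := Real.toNNReal (γ * (L + 1))) (fun t _ => ?_)
      (fun t ht => (hv n t ht).continuousWithinAt) (fun t ht => ?_) (fun _ _ => mem_univ _)
      (fun t ht => ((hv k t ⟨ht.1, ht.2.trans hnk'⟩).continuousWithinAt).mono
        (Icc_subset_Icc le_rfl hnk')) (fun t ht => ?_) (fun _ _ => mem_univ _)
      (by rw [hv0, hv0])
    · refine (LipschitzWith.of_dist_le_mul fun v w => ?_).lipschitzOnWith
      rw [dist_eq_norm, dist_eq_norm, Real.coe_toNNReal _ (by positivity)]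
      exact norm_seekingField_sub_le hL hγ t _ _
    · exact (hv n t ⟨ht.1, ht.2.le⟩).mono_of_mem_nhdsWithin (Icc_mem_nhdsGE_of_mem ht)
    · exact (hv k t ⟨ht.1, ht.2.le.trans hnk'⟩).mono_of_mem_nhdsWithin
        (Icc_mem_nhdsGE_of_mem ⟨ht.1, ht.2.trans_le hnk'⟩)
  set w : ℝ → ℝ × ℝ := fun t => v (⌊t⌋₊ + 1) t with hw
  have hagree : ∀ (n : ℕ), ∀ t ∈ Ico (0 : ℝ) n, w t = v n t := by
    intro n t ht
    have h1 : ⌊t⌋₊ + 1 ≤ n := (Nat.floor_lt ht.1).2 ht.2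
    exact huniq h1 ⟨ht.1, by push_cast; exact (Nat.lt_floor_add_one t).le⟩
  have hderiv : ∀ t, 0 ≤ t → HasDerivWithinAt w (seekingField h γ δ t (w t)) (Ici 0) t := by
    intro t ht
    obtain ⟨n, hn⟩ := exists_nat_gt t
    have hnhds : Ico (0 : ℝ) n ∈ 𝓝[Ici 0] t := by
      rw [← Ici_inter_Iio]
      exact inter_mem self_mem_nhdsWithin (mem_nhdsWithin_of_mem_nhds (Iio_mem_nhds hn))
    rw [hagree n t ⟨ht, hn⟩]
    have h1 : HasDerivWithinAt (v n) (seekingField h γ δ t (v n t)) (Ici 0) t :=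
      (hv n t ⟨ht, hn.le⟩).mono_of_mem_nhdsWithin (mem_of_superset hnhds Ico_subset_Icc_self)
    exact h1.congr_of_eventuallyEq (mem_of_superset hnhds (hagree n)) (hagree n t ⟨ht, hn⟩)
  have hw0 : w 0 = (x₀, y₀) := hv0 _
  exact ⟨fun t => (w t).1, fun t => (w t).2, by simp [hw0], by simp [hw0],
    fun t ht => (ContinuousLinearMap.fst ℝ ℝ ℝ).hasFDerivAt.comp_hasDerivWithinAt t (hderiv t ht),
    fun t ht => (ContinuousLinearMap.snd ℝ ℝ ℝ).hasFDerivAt.comp_hasDerivWithinAt t (hderiv t ht)⟩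

end Field

/-! ### The Lyapunov recursion -/

/-- A discrete Lyapunov argument. Here `p` is the distance to the minimiser, `ζ` the filter error,
`D` the size of the averaged drift and `M` the oscillation, all sampled once per period. The
function `p + 4 K γ ζ` decreases by a fixed amount as long as `p ≥ δ`; otherwise its next value is
below `δ + O(γ)`. -/
theorem lyapunov_recursion {p ζ D M : ℕ → ℝ} {L γ δ K C d Z : ℝ}
    (hL : 0 ≤ L) (hγ : 0 < γ) (hK : 0 ≤ K) (hd : 0 < d)
    (hKγ : K * γ ≤ 1 / 2) (hγs : γ * (3 * K * C + 4 * K * L) ≤ 1 / 2)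
    (hγ1 : γ ≤ 1) (hZ : 2 * L ^ 2 + 2 * L ≤ Z)
    (hp : ∀ n, 0 ≤ p n) (hζ : ∀ n, 0 ≤ ζ n) (hD : ∀ n, 0 ≤ D n) (hM : ∀ n, 0 ≤ M n)
    (hDL : ∀ n, D n ≤ L) (hML : ∀ n, M n ≤ 2 * L) (hζ0 : ζ 0 ≤ Z)
    (hζs : ∀ n, ζ (n + 1) ≤ (1 - γ) * ζ n + L * γ * D n + K * γ ^ 2 * (M n + ζ n))
    (hps : ∀ n, p (n + 1) ≤ p n + γ * D n + K * γ ^ 2 * (M n + ζ n))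
    (hfar : ∀ n, δ ≤ p n → p (n + 1) ≤ p n - γ * D n + K * γ ^ 2 * (M n + ζ n) ∧
      M n ≤ C * D n ∧ d ≤ D n) :
    (∀ n, ζ n ≤ Z) ∧
    (∀ n, p n ≤ max (p 0 + 4 * K * γ * ζ 0) (δ + γ * (3 * L + Z + 4 * K * Z))) ∧
    ∃ N, ∀ n ≥ N, p n ≤ δ + γ * (3 * L + Z + 4 * K * Z) := by
  have hKγ0 : 0 ≤ K * γ := by positivity
  have hζZ : ∀ n, ζ n ≤ Z := by
    intro n
    induction n with
    | zero => exact hζ0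
    | succ n ih =>
      have h1 : L * γ * D n ≤ L * γ * L := mul_le_mul_of_nonneg_left (hDL n) (by positivity)
      have h2 : (1 - γ) * ζ n ≤ (1 - γ) * Z := mul_le_mul_of_nonneg_left ih (by linarith)
      have h3 : K * γ * (γ * (M n + ζ n)) ≤ 1 / 2 * (γ * (2 * L + Z)) :=
        mul_le_mul hKγ (mul_le_mul_of_nonneg_left (add_le_add (hML n) ih) hγ.le)
          (mul_nonneg hγ.le (add_nonneg (hM n) (hζ n))) (by norm_num)
      have h4 := mul_le_mul_of_nonneg_left hZ hγ.le
      have h5 := hζs n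
      linarith
  have hZ0 : 0 ≤ Z := (hζ 0).trans hζ0
  set W : ℕ → ℝ := fun n => p n + 4 * K * γ * ζ n with hW
  set R : ℝ := δ + γ * (3 * L + Z + 4 * K * Z) with hR
  have hpW : ∀ n, p n ≤ W n := fun n => by
    have := mul_nonneg (mul_nonneg zero_le_four hKγ0) (hζ n)
    simp only [hW]; linarith
  have hdesc : ∀ n, δ ≤ p n → W (n + 1) ≤ W n - γ * d / 2 := by
    intro n hn
    obtain ⟨h1, h2, h3⟩ := hfar n hn
    have h4 := mul_le_mul_of_nonneg_left (hζs n) (mul_nonneg zero_le_four hKγ0)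
    have hq : 0 ≤ K * γ ^ 2 := by positivity
    have h5 : K * γ * (4 * (K * γ ^ 2) * (M n + ζ n)) ≤ 1 / 2 * (4 * (K * γ ^ 2) * (M n + ζ n)) :=
      mul_le_mul_of_nonneg_right hKγ
        (mul_nonneg (by positivity) (add_nonneg (hM n) (hζ n)))
    have h6 := mul_le_mul_of_nonneg_left h2 hq
    have h7 := mul_le_mul_of_nonneg_right hγs (mul_nonneg hγ.le (hD n))
    have h8 := mul_le_mul_of_nonneg_left h3 hγ.le
    have h9 := mul_nonneg hq (hζ n)
    simp only [hW]
    linarith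
  have hnear : ∀ n, p n < δ → W (n + 1) ≤ R := by
    intro n hn
    have h1 := hps n
    have h2 : γ * D n ≤ γ * L := mul_le_mul_of_nonneg_left (hDL n) hγ.le
    have h3 : K * γ * (γ * (M n + ζ n)) ≤ 1 / 2 * (γ * (2 * L + Z)) :=
      mul_le_mul hKγ (mul_le_mul_of_nonneg_left (add_le_add (hML n) (hζZ n)) hγ.le)
        (mul_nonneg hγ.le (add_nonneg (hM n) (hζ n))) (by norm_num)
    have h4 : 4 * (K * γ) * ζ (n + 1) ≤ 4 * (K * γ) * Z :=
      mul_le_mul_of_nonneg_left (hζZ _) (by positivity)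
    have h5 := mul_nonneg hγ.le hL
    have h6 := mul_nonneg hγ.le hZ0
    simp only [hW, hR]
    linarith
  have hγd : 0 < γ * d / 2 := by positivity
  have hstep : ∀ n, W (n + 1) ≤ max (W n) R := by
    intro n
    rcases le_or_gt δ (p n) with h | h
    · exact le_max_of_le_left (by linarith [hdesc n h])
    · exact le_max_of_le_right (hnear n h)
  refine ⟨hζZ, fun n => (hpW n).trans ?_, ?_⟩
  · induction n with
    | zero => exact le_max_left _ _
    | succ n ih => exact (hstep n).trans (max_le ih (le_max_right _ _))
  · have hex : ∃ N, W N ≤ R := by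
      by_contra! hcon
      have hlin : ∀ n : ℕ, W n ≤ W 0 - n * (γ * d / 2) := by
        intro n
        induction n with
        | zero => simp
        | succ n ih =>
          have hn : δ ≤ p n := by
            by_contra! h
            exact absurd (hnear n h) (not_le.2 (hcon _))
          push_cast
          linarith [hdesc n hn]
      obtain ⟨n, hn⟩ := exists_nat_gt (W 0 / (γ * d / 2))
      rw [div_lt_iff₀ hγd] at hn
      linarith [hlin n, hpW n, hp n]
    obtain ⟨N, hN⟩ := hex
    refine ⟨N, fun n hn => (hpW n).trans ?_⟩
    induction n, hn using Nat.le_induction with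
    | base => exact hN
    | succ n _ ih => exact (hstep n).trans (max_le ih le_rfl)

/-- A step from `a` towards zero that does not overshoot. -/
theorem abs_sub_mul_eq {a b γ : ℝ} (hab : 0 ≤ a * b) (hγ : 0 ≤ γ) (h : γ * |b| ≤ |a|) :
    |a - γ * b| = |a| - γ * |b| := by
  have hb : |γ * b| = γ * |b| := by rw [abs_mul, abs_of_nonneg hγ]
  have h1 : 0 ≤ a * (γ * b) := by
    have := mul_nonneg hγ hab
    linarith
  rw [← hb] at h ⊢
  have h2 := (abs_sub_abs_le_abs_sub a (γ * b))
  refine le_antisymm ?_ h2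
  refine abs_le_of_sq_le_sq ?_ (by linarith)
  have h3 : |a| * |γ * b| = a * (γ * b) := by rw [← abs_mul, abs_of_nonneg h1]
  have h4 := sq_abs a
  have h5 := sq_abs (γ * b)
  nlinarith

/-! ### Asymptotics of trajectories -/

/-- The states of the trajectory at the integers obey the hypotheses of `lyapunov_recursion`. -/
theorem IsTrajectory.sampled_bounds {h m α : ℝ → ℝ} {L : ℝ≥0} {xs A b γ δ x₀ y₀ : ℝ}
    {x y : ℝ → ℝ} (hh : SmoothWithMinimiser h xs) (hL : LipschitzWith L h) (hγ : 0 < γ)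
    (hKγ : 2 * (L + 1) ^ 2 * γ ≤ 1 / 2) (hδ : 0 < δ)
    (hq : QuasiconvexApprox h xs m α A) (hb : 0 < b) (hAb : A + b ≤ deltaStar α δ)
    (ht : IsTrajectory h γ δ x₀ y₀ x y) {K D M z : ℝ} (hK : K = 2 * (L + 1) ^ 2)
    (hD : D = averagedDrift h δ x₀) (hM : M = oscillation h δ x₀)
    (hz : z = y₀ - meanOutput h δ x₀) :
    |y 1 - meanOutput h δ (x 1)| ≤ (1 - γ) * |z| + L * γ * |D| + K * γ ^ 2 * (M + |z|) ∧
    |x 1 - xs| ≤ |x₀ - xs| + γ * |D| + K * γ ^ 2 * (M + |z|) ∧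
    (δ ≤ |x₀ - xs| → |x 1 - xs| ≤ |x₀ - xs| - γ * |D| + K * γ ^ 2 * (M + |z|) ∧
      M ≤ 220 * |D| ∧ b / 2 ≤ |D|) := by
  have hL0 : (0 : ℝ) ≤ L := L.coe_nonneg
  have hLγ0 : 0 ≤ L * γ := by positivity
  have hLsq : 0 ≤ (L : ℝ) ^ 2 * γ := by positivity
  have hLγ : ((L : ℝ) + 1) * γ ≤ 1 / 2 := by linarith
  obtain ⟨h1, h2, -⟩ := ht.period_estimate hL hγ.le hLγ
  rw [← hD, ← hM, ← hz] at h1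
  rw [← hM, ← hz] at h2
  set B := γ ^ 2 * (M + |z|) with hB
  have hB0 : 0 ≤ B := by
    have := oscillation_nonneg h δ x₀
    rw [← hM] at this
    positivity
  have hE : 2 * (L + 1) * γ ^ 2 * (M + |z|) = 2 * (L + 1) * B := by rw [hB]; ring
  have hE' : K * γ ^ 2 * (M + |z|) = 2 * (L + 1) * B + L * (2 * (L + 1) * B) := by
    rw [hB, hK]; ring
  have hLB : 0 ≤ L * (2 * (L + 1) * B) := by positivity
  rw [hE] at h1 h2
  rw [hE']
  have hγD : |γ * D| = γ * |D| := by rw [abs_mul, abs_of_pos hγ]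
  refine ⟨?_, ?_, fun hfar => ?_⟩
  · have h3 : |x 1 - x₀| ≤ γ * |D| + 2 * (L + 1) * B := by
      have : x 1 - x₀ = (x 1 - x₀ + γ * D) - γ * D := by ring
      rw [this, ← hγD]
      exact (abs_sub _ _).trans (by linarith)
    have h4 := abs_meanOutput_sub_meanOutput_le hL δ x₀ (x 1)
    rw [abs_sub_comm x₀] at h4
    have h5 := mul_le_mul_of_nonneg_left h3 hL0
    have h6 : y 1 - meanOutput h δ (x 1) = (y 1 - y₀ + γ * z) + (1 - γ) * z
        + (meanOutput h δ x₀ - meanOutput h δ (x 1)) := by rw [hz]; ring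
    have h7 : |(1 - γ) * z| = (1 - γ) * |z| := by
      rw [abs_mul, abs_of_nonneg (by linarith)]
    rw [h6]
    refine (abs_add_three _ _ _).trans ?_
    rw [h7]
    linarith
  · have : x 1 - xs = (x 1 - x₀ + γ * D) + (x₀ - xs) + -(γ * D) := by ring
    rw [this]
    refine (abs_add_three _ _ _).trans ?_
    rw [abs_neg, hγD]
    linarith
  · obtain ⟨h3, h4, h5⟩ := drift_of_approx hh hq hδ hb hAb hfar
    rw [← hD] at h3 h4 h5
    rw [← hM] at h4
    refine ⟨?_, h4, h3⟩
    have h6 : γ * |D| ≤ |x₀ - xs| := by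
      have h7 := mul_le_mul_of_nonneg_left (abs_averagedDrift_le hL hδ.le x₀) hγ.le
      rw [← hD] at h7
      have h8 : (L : ℝ) * γ * δ ≤ 1 * δ := mul_le_mul_of_nonneg_right (by linarith) hδ.le
      linarith
    have h7 := abs_sub_mul_eq h5 hγ.le h6
    have : x 1 - xs = (x 1 - x₀ + γ * D) + (x₀ - xs - γ * D) := by ring
    rw [this]
    refine (abs_add_le _ _).trans ?_
    rw [h7]
    linarith

/-- Boundedness and the asymptotic estimate for a trajectory, with explicit conditions on the
parameters. -/
theorem IsTrajectory.bounded_and_limsup_le {h m α : ℝ → ℝ} {L : ℝ≥0} {xs A b γ δ x₀ y₀ K Z ε : ℝ}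
    {x y : ℝ → ℝ} (hh : SmoothWithMinimiser h xs) (hL : LipschitzWith L h) (hγ : 0 < γ)
    (hK : K = 2 * (L + 1) ^ 2) (hZ : Z = 2 * (L : ℝ) ^ 2 + 2 * L + 1)
    (hKγ : K * γ ≤ 1 / 2) (hγ1 : γ ≤ 1) (hγs : γ * (3 * K * 220 + 4 * K * L) ≤ 1 / 2)
    (hε : δ + γ * (3 * L + Z + 4 * K * Z + 2 * (2 * L + Z)) ≤ ε)
    (hδ : 0 < δ) (hδ1 : δ ≤ 1)
    (hq : QuasiconvexApprox h xs m α A) (hb : 0 < b) (hAb : A + b ≤ deltaStar α δ)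
    (hy₀ : |y₀ - meanOutput h δ x₀| ≤ γ) (ht : IsTrajectory h γ δ x₀ y₀ x y) :
    (∃ R : ℝ, ∀ t : ℝ, 0 ≤ t → |x t| ≤ R ∧ |y t| ≤ R) ∧
      limsup (fun t : ℝ => |x t - xs|) atTop ≤ ε := by
  have hL0 : (0 : ℝ) ≤ L := L.coe_nonneg
  have hLδ : (L : ℝ) * δ ≤ L := mul_le_of_le_one_right hL0 hδ1
  have hLγ : ((L : ℝ) + 1) * γ ≤ 1 / 2 := by
    have h1 : 0 ≤ L * γ := by positivity
    have h2 : 0 ≤ (L : ℝ) ^ 2 * γ := by positivity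
    rw [hK] at hKγ
    linarith
  have hML : ∀ n : ℕ, oscillation h δ (x n) ≤ 2 * L := fun n =>
    (oscillation_le hL hδ.le _).trans (by linarith)
  have hsb := fun n : ℕ => (ht.shift n).sampled_bounds hh hL hγ (hK ▸ hKγ) hδ hq hb hAb hK
    rfl rfl rfl
  obtain ⟨hζ, hbound, N, hN⟩ := lyapunov_recursion (p := fun n : ℕ => |x n - xs|)
    (ζ := fun n : ℕ => |y n - meanOutput h δ (x n)|) (D := fun n : ℕ => |averagedDrift h δ (x n)|)
    (M := fun n : ℕ => oscillation h δ (x n)) (L := L) (γ := γ) (δ := δ) (K := K) (C := 220)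
    (d := b / 2) (Z := Z) hL0 hγ (by rw [hK]; positivity) (by positivity) hKγ
    hγs hγ1 (by linarith) (fun _ => abs_nonneg _) (fun _ => abs_nonneg _) (fun _ => abs_nonneg _)
    (fun _ => oscillation_nonneg _ _ _) (fun n => (abs_averagedDrift_le hL hδ.le _).trans hLδ) hML
    (by
      simp only [Nat.cast_zero, ht.init_x, ht.init_y]
      have : 0 ≤ 2 * (L : ℝ) ^ 2 + 2 * L := by positivity
      linarith)
    (fun n => by simpa using (hsb n).1) (fun n => by simpa using (hsb n).2.1)
    (fun n => by simpa using (hsb n).2.2)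
  -- between sampling instants the trajectory moves by at most `r`
  set r : ℝ := γ * (2 * (2 * L + Z)) with hr
  have hbetween : ∀ t : ℝ, 0 ≤ t →
      |x t - x ⌊t⌋₊| ≤ r ∧ |y t - y ⌊t⌋₊| ≤ r := by
    intro t h0
    have h1 := ((ht.shift ⌊t⌋₊).period_estimate hL hγ.le hLγ).2.2 (t - ⌊t⌋₊)
      ⟨by linarith [Nat.floor_le h0], by linarith [Nat.lt_floor_add_one t]⟩
    rw [add_sub_cancel] at h1
    have h2 := mul_le_mul_of_nonneg_left (add_le_add (hML ⌊t⌋₊) (hζ ⌊t⌋₊))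
      (by positivity : 0 ≤ 2 * γ)
    constructor
    · linarith [h1.1]
    · linarith [h1.2]
  constructor
  · set P := max (|x (0 : ℕ) - xs| + 4 * K * γ * |y (0 : ℕ) - meanOutput h δ (x (0 : ℕ))|)
      (δ + γ * (3 * L + Z + 4 * K * Z)) with hP
    refine ⟨r + P + |xs| + (Z + L * P + |meanOutput h δ xs|), fun t h0 => ?_⟩
    obtain ⟨h1, h2⟩ := hbetween t h0
    have h3 := hbound ⌊t⌋₊
    have h4 := hζ ⌊t⌋₊
    have h5 := abs_meanOutput_sub_meanOutput_le hL δ (x ⌊t⌋₊) xs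
    have h6 := mul_le_mul_of_nonneg_left h3 hL0
    have hP0 : 0 ≤ P := (abs_nonneg _).trans h3
    have hLP := mul_nonneg hL0 hP0
    have hZ0 : 0 ≤ Z := (abs_nonneg _).trans h4
    have e1 : x t = (x t - x ⌊t⌋₊) + (x ⌊t⌋₊ - xs) + xs := by ring
    have e2 : y t = (y t - y ⌊t⌋₊) + (y ⌊t⌋₊ - meanOutput h δ (x ⌊t⌋₊))
      + ((meanOutput h δ (x ⌊t⌋₊) - meanOutput h δ xs) + meanOutput h δ xs) := by ring
    constructor
    · rw [e1]
      refine (abs_add_three _ _ _).trans ?_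
      linarith [abs_nonneg (meanOutput h δ xs)]
    · rw [e2]
      refine (abs_add_three _ _ _).trans ?_
      linarith [abs_nonneg xs, abs_add_le (meanOutput h δ (x ⌊t⌋₊) - meanOutput h δ xs)
        (meanOutput h δ xs)]
  · refine limsup_le_of_le (isCoboundedUnder_le_of_le atTop (x := 0) fun t => abs_nonneg _) ?_
    filter_upwards [eventually_ge_atTop (N : ℝ)] with t htN
    have h0 : 0 ≤ t := (Nat.cast_nonneg N).trans htN
    have h1 := (hbetween t h0).1
    have h2 := hN ⌊t⌋₊ (Nat.le_floor htN)
    have h3 := abs_sub_le (x t) (x ⌊t⌋₊) xs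
    linarith

end ExtremumSeeking

theorem theorem2 (L : ℝ≥0) (ε : ℝ) (hε : 0 < ε) :
    ∃ γstar : ℝ, 0 < γstar ∧ ∃ δbar : ℝ, 0 < δbar ∧
      ∀ (h : ℝ → ℝ) (xs : ℝ),
        ExtremumSeeking.SmoothWithMinimiser h xs → LipschitzWith L h →
      ∀ γ : ℝ, 0 < γ → γ < γstar →
      ∀ (δ A : ℝ) (m α : ℝ → ℝ), 0 < δ → δ ≤ δbar →
        ExtremumSeeking.QuasiconvexApprox h xs m α A →
        (∃ b : ℝ, 0 < b ∧ A + b ≤ ExtremumSeeking.deltaStar α δ) →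
      ∀ x₀ y₀ : ℝ, |y₀ - ExtremumSeeking.fourierCos h δ 0 x₀ / 2| ≤ γ →
        (∃ x y : ℝ → ℝ, ExtremumSeeking.IsTrajectory h γ δ x₀ y₀ x y) ∧
        ∀ x y : ℝ → ℝ, ExtremumSeeking.IsTrajectory h γ δ x₀ y₀ x y →
          (∃ R : ℝ, ∀ t : ℝ, 0 ≤ t → |x t| ≤ R ∧ |y t| ≤ R) ∧
          limsup (fun t : ℝ => |x t - xs|) atTop ≤ ε := by
  obtain ⟨K, hK⟩ : ∃ K : ℝ, K = 2 * (L + 1) ^ 2 := ⟨_, rfl⟩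
  obtain ⟨Z, hZ⟩ : ∃ Z : ℝ, Z = 2 * (L : ℝ) ^ 2 + 2 * L + 1 := ⟨_, rfl⟩
  obtain ⟨B, hB⟩ : ∃ B : ℝ, B = 3 * L + Z + 4 * K * Z + 2 * (2 * L + Z) := ⟨_, rfl⟩
  have hK0 : 0 < K := by rw [hK]; positivity
  have hZ0 : 0 < Z := by rw [hZ]; positivity
  have hB0 : 0 < B := by rw [hB]; positivity
  -- each summand of `G` enforces one smallness condition on `γ` through `γ * G < 1`
  set G : ℝ := 1 + 2 * K + 2 * (3 * K * 220 + 4 * K * L) + 2 * B / ε with hG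
  have hG0 : 0 < G := by positivity
  refine ⟨1 / G, by positivity, min 1 (ε / 2), by positivity, ?_⟩
  intro h xs hh hL γ hγ hγG δ A m α hδ hδb hq ⟨b, hb, hAb⟩ x₀ y₀ hy₀
  rw [ExtremumSeeking.fourierCos_zero_div_two] at hy₀
  rw [lt_div_iff₀ hG0] at hγG
  have g1 : 0 < γ * K := by positivity
  have g2 : 0 < γ * (3 * K * 220 + 4 * K * L) := by positivity
  have g3 : 0 < γ * (2 * B / ε) := by positivity
  have hsum : γ + 2 * (γ * K) + 2 * (γ * (3 * K * 220 + 4 * K * L)) + γ * (2 * B / ε) < 1 := by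
    rw [hG] at hγG; linarith
  have hγB : γ * B ≤ ε / 2 := by
    have : γ * (2 * B / ε) = 2 * (γ * B) / ε := by ring
    rw [this] at hsum
    have h1 : 2 * (γ * B) / ε ≤ 1 := by linarith
    rw [div_le_one hε] at h1
    linarith
  refine ⟨ExtremumSeeking.exists_isTrajectory hL hγ.le hδ.le x₀ y₀, fun x y ht => ?_⟩
  refine ht.bounded_and_limsup_le hh hL hγ hK hZ (by linarith) (by linarith) (by linarith) ?_ hδ
    (hδb.trans (min_le_left _ _)) hq hb hAb hy₀
  rw [← hB]
  linarith [hδb.trans (min_le_right _ _)]
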